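/- **Notation.** For a probability measure $\eta$ on $\mathbb R$ let $F_\eta^{-1}(u)=\inf\{x:\eta((-\infty,x])\ge u\}$, $u\in(0,1)$; write $\eta\le_{st}\eta'$ if $F_\eta^{-1}\le F_{\eta'}^{-1}$ on $(0,1)$. $\mathcal P_1(\mathbb R)$ is the set of probability measures on $\mathbb R$ with finite first moment, $\mu\le_{cx}\nu$ is the convex order, $\Pi(\cdot,\cdot)$ denotes sets of couplings, $\lambda_{(0,1)}$ is Lebesgue measure on $(0,1)$, and $\mathcal W_1$ is the Wasserstein distance of order one. For $\pi,\pi'$ with first marginals $\mu,\mu'$ and disintegrations $\pi=\mu\times\pi_x$, $\pi'=\mu'\times\pi'_x$, $$\mathcal{AW}_1(\pi,\pi')=\inf_{\chi\in\Pi(\mu,\mu')}\int(|x-x'|+\mathcal W_1(\pi_x,\pi'_{x'}))\,\chi(dx,dx').$$ A *lifted coupling* between $\mu$ and $\nu$ is a measure $\widehat\pi=\lambda_{(0,1)}(du)\,\delta_{F_\mu^{-1}(u)}(dx)\,p_u(dy)$ on $(0,1)\times\mathbb R\times\mathbb R$, with $(p_u)$ a probability kernel, whose marginal in $(x,y)$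 lies in $\Pi(\mu,\nu)$ (it is then called a lifted coupling of that marginal). It is a *lifted martingale coupling*, $\widehat\pi\in\widehat\Pi^{\mathrm M}(\mu,\nu)$, if $\int y\,p_u(dy)=F_\mu^{-1}(u)$ for almost every $u$. With $\widehat\pi_u=\delta_{F_\mu^{-1}(u)}\times p_u$ the disintegration in $u$, $$\widehat{\mathcal{AW}}_1(\widehat\pi,\widehat\pi')=\inf_{\chi\in\Pi(\lambda_{(0,1)},\lambda_{(0,1)})}\int(|u-u'|+\mathcal{AW}_1(\widehat\pi_u,\widehat\pi'_{u'}))\,\chi(du,du').$$ A lifted martingale rearrangement coupling of $\widehat\pi$ is an $\widehat M\in\widehat\Pi^{\mathrm M}(\mu,\nu)$ with $\widehat{\mathcal{AW}}_1(\widehat\pi,\widehat M)=\inf_{\widehat M'\in\widehat\Pi^{\mathrm M}(\mu,\nu)}\widehat{\mathcal{AW}}_1(\widehat\pi,\widehat M')$. **Exchange maps.** Let $\mathfrak B$ be the set of $(y,\tilde y,\eta,\tilde\eta)\in\mathbb R^2\times\mathcal P_1(\mathbb R)^2$ such that the means $x,\tilde x$ of $\eta,\tilde\eta$ satisfy $x<y\le\tilde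 y<\tilde x$, and put $p=\frac{\tilde x-\tilde y}{y-x+\tilde x-\tilde y}$. A pair of exchange maps is a pair of measurable maps $\beta,\tilde\beta:\mathfrak B\to\mathcal P_1(\mathbb R)$ (for the Borel $\sigma$-algebra of weak convergence) such that on all of $\mathfrak B$ the measures $\beta,\tilde\beta$ have means $y,\tilde y$, $\eta\le_{st}\beta$, $\tilde\beta\le_{st}\tilde\eta$ and $p\beta+(1-p)\tilde\beta=p\eta+(1-p)\tilde\eta$. The explicit pair is as follows. Let $$J(q)=\int_0^{q/p}F_{\tilde\eta}^{-1}\Big(\tfrac{1-pu-p}{1-p}\Big)du+\int_{q/p}^1F_\eta^{-1}(u)\,du,\qquad \tilde J(q)=\int_0^{q/(1-p)}F_\eta^{-1}\Big(\tfrac{(1-p)u}{p}\Big)du+\int_0^{\frac{1-q-p}{1-p}}F_{\tilde\eta}^{-1}(u)\,du,$$ let $q_\star$ be the solution in $[0,p]$ of $J(q)=y$ if $p\le\frac12$ and the solution in $[0,1-p]$ of $\tilde J(q)=\tilde y$ if $p>\frac12$, and let $\beta,\tilde\beta$ be the images of $\lambda_{(0,1)}$ under $$u\mapsto \mathbf 1_{\{u<q_\star/p\}}F_{\tilde\eta}^{-1}\Big(\tfrac{1-pu-p}{1-p}\Big)+\mathbf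 1_{\{u\ge q_\star/p\}}F_\eta^{-1}(u),\qquad u\mapsto \mathbf 1_{\{u<\frac{q_\star}{1-p}\}}F_\eta^{-1}\Big(\tfrac{(1-p)u}{p}\Big)+\mathbf 1_{\{u\ge\frac{q_\star}{1-p}\}}F_{\tilde\eta}^{-1}\Big(u-\tfrac{q_\star}{1-p}\Big).$$ **The kernel $m$.** Let $\mu,\nu\in\mathcal P_1(\mathbb R)$ with $\mu\le_{cx}\nu$, $\mu\ne\nu$, and let $\pi=\mu\times\pi_x\in\Pi(\mu,\nu)$ satisfy the barycentre dispersion assumption $$\forall a\in\mathbb R,\quad \int_{[a,\infty)}\Big(x-\int y\,\pi_x(dy)\Big)\mu(dx)\le0 .$$ Put $G(u)=\int y\,\pi_{F_\mu^{-1}(u)}(dy)$, which exists for almost every $u$, $\Delta_\pm(u)=\int_0^u(F_\mu^{-1}-G)^\pm(v)\,dv$, $\Delta_\pm^{-1}(v)=\inf\{r\in[0,1]:\Delta_\pm(r)\ge v\}$, and let $\mathcal U^+$ (resp. $\mathcal U^-$) be the set of $u\in(0,1)$ for which $G(u)$ exists and $F_\mu^{-1}(u)>G(u)$ (resp. $<$).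 Let $\phi=\Delta_-^{-1}\circ\Delta_+$ on $\mathcal U^+$, $\phi=\Delta_+^{-1}\circ\Delta_-$ on $\mathcal U^-$, $\phi(u)=u$ otherwise, and $$p(u)=\frac{G(\phi(u))-F_\mu^{-1}(\phi(u))}{F_\mu^{-1}(u)-G(u)+G(\phi(u))-F_\mu^{-1}(\phi(u))}.$$ Let $A^\pm=\{u\in\mathcal U^\pm:\phi(u)\in\mathcal U^\mp,\ \phi(\phi(u))=u,\ p(\phi(u))=1-p(u)\}$ and $b(u)=(F_\mu^{-1}(u),F_\mu^{-1}(\phi(u)),\pi_{F_\mu^{-1}(u)},\pi_{F_\mu^{-1}(\phi(u))})$. Given exchange maps $\beta,\tilde\beta$, set $m_u=\beta(b(u))$ for $u\in A^+$, $m_u=\tilde\beta(b(\phi(u)))$ for $u\in A^-$, and $m_u=\pi_{F_\mu^{-1}(u)}$ for all other $u$. Put $$\widehat M=\lambda_{(0,1)}(du)\,\delta_{F_\mu^{-1}(u)}(dx)\,m_u(dy),\qquad \iota(\pi)=\lambda_{(0,1)}(du)\,\delta_{F_\mu^{-1}(u)}(dx)\,\pi_{F_\mu^{-1}(u)}(dy).$$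 **Proposition.** The explicit pair is a pair of exchange maps. Moreover, under the above hypotheses on $\mu,\nu,\pi$, and for every choice of the disintegration $(\pi_x)$ and of the pair of exchange maps: $(m_u)$ is a probability kernel, $\iota(\pi)$ is a lifted coupling of $\pi$, and $\widehat M$ is a lifted martingale coupling between $\mu$ and $\nu$ and a lifted martingale rearrangement coupling of $\iota(\pi)$, with $$\inf_{\widehat M'\in\widehat\Pi^{\mathrm M}(\mu,\nu)}\widehat{\mathcal{AW}}_1(\iota(\pi),\widehat M')=\widehat{\mathcal{AW}}_1(\iota(\pi),\widehat M)=\int_0^1\mathcal W_1(\pi_{F_\mu^{-1}(u)},m_u)\,du=\int_0^1|G(u)-F_\mu^{-1}(u)|\,du<\infty .$$ -/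

import Mathlib

open MeasureTheory ProbabilityTheory Set

noncomputable section

namespace MartRearr

/-! ### Quantile functions, orders, couplings -/

/-- `η` is a probability measure on `ℝ` with finite first moment. -/
def IsP1 (η : Measure ℝ) : Prop :=
  IsProbabilityMeasure η ∧ Integrable (fun x : ℝ => x) η

/-- Quantile function `F_η⁻¹(u) = inf {x : η((-∞, x]) ≥ u}`, only meaningful for `u ∈ (0,1)`. -/
def quantile (η : Measure ℝ) (u : ℝ) : ℝ :=
  sInf {x : ℝ | u ≤ η.real (Iic x)}

/-- Stochastic order `η ≤_st η'`. -/
def StochLE (η η' : Measure ℝ) : Prop :=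
  ∀ u ∈ Ioo (0 : ℝ) 1, quantile η u ≤ quantile η' u

/-- Convex order `μ ≤_cx ν`. A convex function is bounded below by an affine one, so its integrals
against measures with finite first moment make sense in `(-∞, ∞]`; by truncation to convex functions
of linear growth it is equivalent to test only convex functions with two finite integrals. -/
def ConvexOrder (μ ν : Measure ℝ) : Prop :=
  ∀ f : ℝ → ℝ, ConvexOn ℝ univ f → Integrable f μ → Integrable f ν → ∫ x, f x ∂μ ≤ ∫ y, f y ∂ν

/-- `χ` has marginals `α` and `β`. -/
def IsCoupling {X Y : Type*} [MeasurableSpace X] [MeasurableSpace Y]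
    (α : Measure X) (β : Measure Y) (χ : Measure (X × Y)) : Prop :=
  χ.map Prod.fst = α ∧ χ.map Prod.snd = β

/-- Disintegration `(ρ_x)` of a finite measure `ρ` with respect to its first marginal,
`ρ(dx, dω) = ρ₁(dx) ρ_x(dω)`. (The value `0` for infinite measures is never used.) -/
def disint {X Ω : Type*} [MeasurableSpace X] [MeasurableSpace Ω] [StandardBorelSpace Ω]
    [Nonempty Ω] (ρ : Measure (X × Ω)) (x : X) : Measure Ω :=
  open scoped Classical in
  if h : IsFiniteMeasure ρ then (haveI := h; ρ.condKernel x) else 0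

/-! ### Wasserstein and adapted Wasserstein distances of order one -/

/-- Wasserstein distance `W₁` on measures on the line. -/
def W1 (η η' : Measure ℝ) : ENNReal :=
  ⨅ (χ : Measure (ℝ × ℝ)) (_ : IsCoupling η η' χ), ∫⁻ z, ENNReal.ofReal |z.1 - z.2| ∂χ

/-- Adapted Wasserstein distance `AW₁` on measures on `ℝ × ℝ`. -/
def AW1 (π π' : Measure (ℝ × ℝ)) : ENNReal :=
  ⨅ (χ : Measure (ℝ × ℝ)) (_ : IsCoupling (π.map Prod.fst) (π'.map Prod.fst) χ),
    ∫⁻ z, (ENNReal.ofReal |z.1 - z.2| + W1 (disint π z.1) (disint π' z.2)) ∂χ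

/-- Lifted adapted Wasserstein distance of order one on measures on `ℝ × ℝ × ℝ ∋ (u, x, y)`. -/
def liftedAW1 (P P' : Measure (ℝ × ℝ × ℝ)) : ENNReal :=
  ⨅ (χ : Measure (ℝ × ℝ)) (_ : IsCoupling (P.map Prod.fst) (P'.map Prod.fst) χ),
    ∫⁻ z, (ENNReal.ofReal |z.1 - z.2| + AW1 (disint P z.1) (disint P' z.2)) ∂χ

/-! ### Lifted couplings -/

/-- Lebesgue measure on `(0,1)`, as a measure on `ℝ`. -/
def lam : Measure ℝ := volume.restrict (Ioo (0 : ℝ) 1)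

/-- The measure `λ_(0,1)(du) δ_{F_μ⁻¹(u)}(dx) p_u(dy)` for a measurable family `p`. -/
def lift (μ : Measure ℝ) (p : ℝ → Measure ℝ) : Measure (ℝ × ℝ × ℝ) :=
  lam.bind fun u => (Measure.dirac u).prod ((Measure.dirac (quantile μ u)).prod (p u))

/-- `P` is a lifted coupling of `π`, where `π` is a coupling whose first marginal is `μ`. -/
def IsLiftOf (μ : Measure ℝ) (π : Measure (ℝ × ℝ)) (P : Measure (ℝ × ℝ × ℝ)) : Prop :=
  (∃ p : Kernel ℝ ℝ, IsMarkovKernel p ∧ P = lift μ p) ∧ P.map Prod.snd = π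

/-- `P ∈ Π̂(μ, ν)`: `P` is a lifted coupling of some coupling between `μ` and `ν`. -/
def IsLiftedCoupling (μ ν : Measure ℝ) (P : Measure (ℝ × ℝ × ℝ)) : Prop :=
  ∃ π : Measure (ℝ × ℝ), IsCoupling μ ν π ∧ IsLiftOf μ π P

/-- `P ∈ Π̂ᴹ(μ, ν)`: lifted martingale couplings. -/
def IsLiftedMartingaleCoupling (μ ν : Measure ℝ) (P : Measure (ℝ × ℝ × ℝ)) : Prop :=
  IsLiftedCoupling μ ν P ∧
    ∃ p : Kernel ℝ ℝ, IsMarkovKernel p ∧ P = lift μ p ∧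
      ∀ᵐ u ∂lam, Integrable (fun y : ℝ => y) (p u) ∧ ∫ y, y ∂(p u) = quantile μ u

/-- `inf` of the lifted adapted Wasserstein distance from `P` to `Π̂ᴹ(μ, ν)`. -/
def infLiftedAW1 (μ ν : Measure ℝ) (P : Measure (ℝ × ℝ × ℝ)) : ENNReal :=
  ⨅ (M' : Measure (ℝ × ℝ × ℝ)) (_ : IsLiftedMartingaleCoupling μ ν M'), liftedAW1 P M'

/-- `M` is a lifted martingale rearrangement coupling of `P`. -/
def IsLiftedMartingaleRearrangement (μ ν : Measure ℝ) (P M : Measure (ℝ × ℝ × ℝ)) : Prop :=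
  IsLiftedMartingaleCoupling μ ν M ∧ liftedAW1 P M = infLiftedAW1 μ ν P

/-- The embedding `ι`, for `π(dx, dy) = μ(dx) κ_x(dy)`. -/
def iota (μ : Measure ℝ) (κ : Kernel ℝ ℝ) : Measure (ℝ × ℝ × ℝ) :=
  lift μ fun u => κ (quantile μ u)

/-- Barycentre dispersion assumption for `π(dx, dy) = μ(dx) κ_x(dy)`. -/
def BarycentreDispersion (μ : Measure ℝ) (κ : Kernel ℝ ℝ) : Prop :=
  ∀ a : ℝ, ∫ x in Ici a, (x - ∫ y, y ∂(κ x)) ∂μ ≤ 0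

/-! ### Exchanging mass between two measures

A quadruple `(y, y', η, η')` consists of two reals and two laws. -/

/-- Quadruples with `η, η'` of means `x, x'` such that `x < y ≤ y' < x'`. -/
def quadruples : Set (ℝ × ℝ × Measure ℝ × Measure ℝ) :=
  {b | IsP1 b.2.2.1 ∧ IsP1 b.2.2.2 ∧
    ∫ w, w ∂b.2.2.1 < b.1 ∧ b.1 ≤ b.2.1 ∧ b.2.1 < ∫ w, w ∂b.2.2.2}

/-- The weight `(x' - y') / (y - x + x' - y')`. -/
def weight (b : ℝ × ℝ × Measure ℝ × Measure ℝ) : ℝ :=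
  (∫ w, w ∂b.2.2.2 - b.2.1) / (b.1 - ∫ w, w ∂b.2.2.1 + ∫ w, w ∂b.2.2.2 - b.2.1)

/-- `β, β'` exchange mass: for `b = (y, y', η, η')` the laws `β b, β' b` have means `y, y'`,
`η ≤_st β b`, `β' b ≤_st η'` and `p β b + (1 - p) β' b = p η + (1 - p) η'`; and both maps are
measurable on the quadruples. The `σ`-algebra on measures is generated by the evaluations; on
probability measures it is the Borel `σ`-algebra of weak convergence. -/
structure IsExchange (β β' : ℝ × ℝ × Measure ℝ × Measure ℝ → Measure ℝ) : Prop where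
  measurable_fst : Measurable fun b : quadruples => β b
  measurable_snd : Measurable fun b : quadruples => β' b
  isP1_fst : ∀ b ∈ quadruples, IsP1 (β b)
  isP1_snd : ∀ b ∈ quadruples, IsP1 (β' b)
  mean_fst : ∀ b ∈ quadruples, ∫ w, w ∂(β b) = b.1
  mean_snd : ∀ b ∈ quadruples, ∫ w, w ∂(β' b) = b.2.1
  stochLE_fst : ∀ b ∈ quadruples, StochLE b.2.2.1 (β b)
  stochLE_snd : ∀ b ∈ quadruples, StochLE (β' b) b.2.2.2
  mixture : ∀ b ∈ quadruples,
    ENNReal.ofReal (weight b) • β b + ENNReal.ofReal (1 - weight b) • β' b =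
      ENNReal.ofReal (weight b) • b.2.2.1 + ENNReal.ofReal (1 - weight b) • b.2.2.2

/-- The function `J`. -/
def fnJ (b : ℝ × ℝ × Measure ℝ × Measure ℝ) (q : ℝ) : ℝ :=
  (∫ u in (0 : ℝ)..(q / weight b),
      quantile b.2.2.2 ((1 - weight b * u - weight b) / (1 - weight b))) +
    ∫ u in (q / weight b)..1, quantile b.2.2.1 u

/-- The function `J̃`. -/
def fnJ' (b : ℝ × ℝ × Measure ℝ × Measure ℝ) (q : ℝ) : ℝ :=
  (∫ u in (0 : ℝ)..(q / (1 - weight b)), quantile b.2.2.1 ((1 - weight b) * u / weight b)) +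
    ∫ u in (0 : ℝ)..((1 - q - weight b) / (1 - weight b)), quantile b.2.2.2 u

/-- The amount `q⋆` of mass to exchange: the unique solution of `J(q) = y` in `[0, p]` if
`p ≤ 1/2`, and of `J̃(q) = y'` in `[0, 1 - p]` otherwise. -/
def qStar (b : ℝ × ℝ × Measure ℝ × Measure ℝ) : ℝ :=
  if weight b ≤ 1 / 2 then sInf {q | q ∈ Icc 0 (weight b) ∧ fnJ b q = b.1}
  else sInf {q | q ∈ Icc 0 (1 - weight b) ∧ fnJ' b q = b.2.1}

/-- The explicit first exchanged law. -/
def exchangeFst (b : ℝ × ℝ × Measure ℝ × Measure ℝ) : Measure ℝ :=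
  lam.map fun u =>
    if u < qStar b / weight b then
      quantile b.2.2.2 ((1 - weight b * u - weight b) / (1 - weight b))
    else quantile b.2.2.1 u

/-- The explicit second exchanged law. -/
def exchangeSnd (b : ℝ × ℝ × Measure ℝ × Measure ℝ) : Measure ℝ :=
  lam.map fun u =>
    if u < qStar b / (1 - weight b) then quantile b.2.2.1 ((1 - weight b) * u / weight b)
    else quantile b.2.2.2 (u - qStar b / (1 - weight b))

/-! ### The martingale kernel `m` built from `π(dx, dy) = μ(dx) κ_x(dy)` -/

/-- `G(u) = ∫ y κ_{F_μ⁻¹(u)}(dy)`. -/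
def G (μ : Measure ℝ) (κ : Kernel ℝ ℝ) (u : ℝ) : ℝ := ∫ y, y ∂(κ (quantile μ u))

/-- `Δ₊(u) = ∫₀ᵘ (F_μ⁻¹ - G)⁺`. -/
def DeltaPos (μ : Measure ℝ) (κ : Kernel ℝ ℝ) (u : ℝ) : ℝ :=
  ∫ v in (0 : ℝ)..u, max (quantile μ v - G μ κ v) 0

/-- `Δ₋(u) = ∫₀ᵘ (F_μ⁻¹ - G)⁻`. -/
def DeltaNeg (μ : Measure ℝ) (κ : Kernel ℝ ℝ) (u : ℝ) : ℝ :=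
  ∫ v in (0 : ℝ)..u, max (-(quantile μ v - G μ κ v)) 0

/-- Left-continuous generalized inverse of a nondecreasing function on `[0,1]`. -/
def genInv (D : ℝ → ℝ) (v : ℝ) : ℝ := sInf {r | r ∈ Icc (0 : ℝ) 1 ∧ v ≤ D r}

/-- `𝒰⁺ = {u ∈ (0,1) : F_μ⁻¹(u) > G(u)}`; the levels `u` (Lebesgue-null many under finite first
moments) at which the mean `G(u)` does not exist are left out. -/
def UPos (μ : Measure ℝ) (κ : Kernel ℝ ℝ) : Set ℝ :=
  {u | u ∈ Ioo (0 : ℝ) 1 ∧ Integrable (fun y : ℝ => y) (κ (quantile μ u)) ∧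
    G μ κ u < quantile μ u}

/-- `𝒰⁻ = {u ∈ (0,1) : F_μ⁻¹(u) < G(u)}`, with the same proviso. -/
def UNeg (μ : Measure ℝ) (κ : Kernel ℝ ℝ) : Set ℝ :=
  {u | u ∈ Ioo (0 : ℝ) 1 ∧ Integrable (fun y : ℝ => y) (κ (quantile μ u)) ∧
    quantile μ u < G μ κ u}

/-- The map `φ`. -/
def phi (μ : Measure ℝ) (κ : Kernel ℝ ℝ) (u : ℝ) : ℝ :=
  open scoped Classical in
  if u ∈ UPos μ κ then genInv (DeltaNeg μ κ) (DeltaPos μ κ u)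
  else if u ∈ UNeg μ κ then genInv (DeltaPos μ κ) (DeltaNeg μ κ u)
  else u

/-- The weight `p(u)`. -/
def pw (μ : Measure ℝ) (κ : Kernel ℝ ℝ) (u : ℝ) : ℝ :=
  (G μ κ (phi μ κ u) - quantile μ (phi μ κ u)) /
    (quantile μ u - G μ κ u + G μ κ (phi μ κ u) - quantile μ (phi μ κ u))

/-- The set `A⁺`. -/
def APos (μ : Measure ℝ) (κ : Kernel ℝ ℝ) : Set ℝ :=
  {u | u ∈ UPos μ κ ∧ phi μ κ u ∈ UNeg μ κ ∧ phi μ κ (phi μ κ u) = u ∧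
    pw μ κ (phi μ κ u) = 1 - pw μ κ u}

/-- The set `A⁻`. -/
def ANeg (μ : Measure ℝ) (κ : Kernel ℝ ℝ) : Set ℝ :=
  {u | u ∈ UNeg μ κ ∧ phi μ κ u ∈ UPos μ κ ∧ phi μ κ (phi μ κ u) = u ∧
    pw μ κ (phi μ κ u) = 1 - pw μ κ u}

/-- The quadruple `(F_μ⁻¹(u), F_μ⁻¹(φ(u)), κ_{F_μ⁻¹(u)}, κ_{F_μ⁻¹(φ(u))})`. -/
def quad (μ : Measure ℝ) (κ : Kernel ℝ ℝ) (u : ℝ) : ℝ × ℝ × Measure ℝ × Measure ℝ :=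
  (quantile μ u, quantile μ (phi μ κ u), κ (quantile μ u), κ (quantile μ (phi μ κ u)))

/-- The family `m_u`: exchanged laws on `A⁺ ∪ A⁻`, and `κ_{F_μ⁻¹(u)}` elsewhere. -/
def mker (β β' : ℝ × ℝ × Measure ℝ × Measure ℝ → Measure ℝ) (μ : Measure ℝ) (κ : Kernel ℝ ℝ)
    (u : ℝ) : Measure ℝ :=
  open scoped Classical in
  if u ∈ APos μ κ then β (quad μ κ u)
  else if u ∈ ANeg μ κ then β' (quad μ κ (phi μ κ u))
  else κ (quantile μ u)

/-- The lifted measure `M̂ = λ_(0,1)(du) δ_{F_μ⁻¹(u)}(dx) m_u(dy)`. -/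
def Mhat (β β' : ℝ × ℝ × Measure ℝ × Measure ℝ → Measure ℝ) (μ : Measure ℝ) (κ : Kernel ℝ ℝ) :
    Measure (ℝ × ℝ × ℝ) :=
  lift μ (mker β β' μ κ)

end MartRearr

end

open MartRearr

/-!
The mean defect `|G(u) - F_μ⁻¹(u)|` is a lower bound for the adapted Wasserstein distance between
`δ_{F_μ⁻¹(u)} × κ_{F_μ⁻¹(u)}` and `δ_x × η` as soon as `η` has mean `x`, so every lifted martingale
coupling lies at distance at least `∫ |G - F_μ⁻¹|` from `ι(π)`. The coupling `M̂` attains this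
bound. Equality of the means gives `Δ₊(1) = Δ₋(1)`, so `φ` transports `(F_μ⁻¹ - G)⁺ du` to
`(F_μ⁻¹ - G)⁻ du`, and the dispersion assumption gives `Δ₋ ≤ Δ₊`, hence `u ≤ φ(u)` on `𝒰⁺`:
a level of surplus is paired with a higher level of deficit, as exchange maps require. An exchange
moves the law at each of the two levels monotonically in the stochastic order, so that `W₁` between
the old and the new law is the difference of their means. It preserves the mixture of the two laws
with weights `p(u)` and `1 - p(u)`, which are inversely proportional to the two defects; as `φ`
distorts Lebesgue measure by the ratio of the defects, the second marginal remains `ν`.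

For the explicit pair, exchanging an additional amount `q` of mass moves the lower mean upwards at
a rate that is the gap between a decreasing upper quantile and an increasing lower one. This rate
is nonincreasing and its total exceeds what is needed, so the mean hits `y` exactly once and the
gap is nonnegative up to that time, which is the required stochastic ordering.
-/

namespace MartRearr

/-! ### Quantile functions -/

lemma lam_eq_restrict_Ioc : lam = volume.restrict (Ioc (0 : ℝ) 1) :=
  Measure.restrict_congr_set Ioo_ae_eq_Ioc

instance : IsProbabilityMeasure lam := ⟨by simp [lam]⟩

instance : NullSingletonClass lam := by unfold lam; infer_instance

lemma ae_lam_mem : ∀ᵐ u ∂lam, u ∈ Ioo (0 : ℝ) 1 := ae_restrict_mem measurableSet_Ioo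

lemma lam_restrict_Iic {t : ℝ} (ht : t ≤ 1) : lam.restrict (Iic t) = volume.restrict (Ioc 0 t) := by
  rw [lam_eq_restrict_Ioc, Measure.restrict_restrict measurableSet_Iic, inter_comm,
    Ioc_inter_Iic, min_eq_right ht]

lemma lam_Iic {t : ℝ} (ht : t ≤ 1) : lam (Iic t) = ENNReal.ofReal t := by
  rw [← Measure.restrict_apply_univ, lam_restrict_Iic ht, Measure.restrict_apply_univ,
    Real.volume_Ioc, sub_zero]

section Quantile

variable {η η' : Measure ℝ} [IsProbabilityMeasure η] [IsProbabilityMeasure η'] {u x : ℝ}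

lemma monotone_measureReal_Iic (η : Measure ℝ) [IsFiniteMeasure η] :
    Monotone fun x => η.real (Iic x) :=
  fun _ _ h => measureReal_mono (Iic_subset_Iic.2 h)

lemma bddBelow_setOf_le_cdf (hu : 0 < u) : BddBelow {x | u ≤ η.real (Iic x)} := by
  obtain ⟨z, hz⟩ := ((tendsto_cdf_atBot η).eventually (gt_mem_nhds hu)).exists
  rw [cdf_eq_real] at hz
  exact ⟨z, fun w hw => not_lt.1 fun hwz =>
    (hz.trans_le hw).not_ge (monotone_measureReal_Iic η hwz.le)⟩

lemma nonempty_setOf_le_cdf (hu : u < 1) : {x | u ≤ η.real (Iic x)}.Nonempty := by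
  obtain ⟨z, hz⟩ := ((tendsto_cdf_atTop η).eventually (lt_mem_nhds hu)).exists
  exact ⟨z, (cdf_eq_real η z ▸ hz).le⟩

lemma quantile_le_iff_of_nonempty (hu : 0 < u) (hne : {x | u ≤ η.real (Iic x)}.Nonempty) :
    quantile η u ≤ x ↔ u ≤ η.real (Iic x) := by
  refine ⟨fun h => ?_, fun h => csInf_le (bddBelow_setOf_le_cdf hu) h⟩
  have hright : Filter.Tendsto (fun x => η.real (Iic x)) (nhdsWithin x (Ioi x))
      (nhds (η.real (Iic x))) := by
    simpa only [funext (cdf_eq_real η)] using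
      ((cdf η).right_continuous x).mono_left (nhdsWithin_mono x Ioi_subset_Ici_self)
  refine ge_of_tendsto hright ?_
  filter_upwards [self_mem_nhdsWithin] with x' hx'
  obtain ⟨s, hs, hsx⟩ := exists_lt_of_csInf_lt hne (lt_of_le_of_lt h hx')
  exact hs.trans (monotone_measureReal_Iic η hsx.le)

lemma quantile_le_iff (hu : u ∈ Ioo (0 : ℝ) 1) : quantile η u ≤ x ↔ u ≤ η.real (Iic x) :=
  quantile_le_iff_of_nonempty hu.1 (nonempty_setOf_le_cdf hu.2)

lemma monotoneOn_quantile (η : Measure ℝ) [IsProbabilityMeasure η] :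
    MonotoneOn (quantile η) (Ioo 0 1) := fun _ hu _ hv huv =>
  (quantile_le_iff hu).2 (huv.trans ((quantile_le_iff hv).1 le_rfl))

lemma quantile_of_nonpos {η : Measure ℝ} (hu : u ≤ 0) : quantile η u = 0 := by
  have huniv : {x : ℝ | u ≤ η.real (Iic x)} = univ :=
    eq_univ_of_forall fun _ => hu.trans measureReal_nonneg
  rw [quantile, huniv, Real.sInf_univ]

lemma quantile_eq_zero_of_forall_lt {η : Measure ℝ} (hu : ∀ n : ℕ, η.real (Iic (n : ℝ)) < u)
    [IsFiniteMeasure η] : quantile η u = 0 := by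
  have hempty : {x : ℝ | u ≤ η.real (Iic x)} = ∅ := by
    refine eq_empty_of_forall_notMem fun x hx => ?_
    obtain ⟨n, hn⟩ := exists_nat_ge x
    exact (hu n).not_ge (le_trans hx (monotone_measureReal_Iic η hn))
  rw [quantile, hempty, Real.sInf_empty]

lemma measurable_quantile_kernel {X : Type*} [MeasurableSpace X] (κ : Kernel X ℝ)
    [IsMarkovKernel κ] : Measurable fun z : X × ℝ => quantile (κ z.1) z.2 := by
  have hm (x : ℝ) : MeasurableSet {z : X × ℝ | z.2 ≤ (κ z.1).real (Iic x)} :=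
    measurableSet_le measurable_snd
      ((κ.measurable_coe measurableSet_Iic).comp measurable_fst).ennreal_toReal
  -- Off `E` the infimum defining the quantile takes its junk value `0`.
  let E : Set (X × ℝ) := {z | 0 < z.2} ∩ ⋃ n : ℕ, {z | z.2 ≤ (κ z.1).real (Iic (n : ℝ))}
  have hE : MeasurableSet E :=
    (measurableSet_lt measurable_const measurable_snd).inter (MeasurableSet.iUnion fun n => hm n)
  have quantile_of_mem {z : X × ℝ} (x : ℝ) (hz : z ∈ E) :
      quantile (κ z.1) z.2 ≤ x ↔ z.2 ≤ (κ z.1).real (Iic x) := by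
    obtain ⟨n, hn⟩ := mem_iUnion.1 hz.2
    exact quantile_le_iff_of_nonempty hz.1 ⟨n, hn⟩
  have quantile_of_notMem {z : X × ℝ} (hz : z ∉ E) : quantile (κ z.1) z.2 = 0 := by
    rcases le_or_gt z.2 0 with h0 | h0
    · exact quantile_of_nonpos h0
    · exact quantile_eq_zero_of_forall_lt fun n =>
        not_le.1 fun hn => hz ⟨h0, mem_iUnion.2 ⟨n, hn⟩⟩
  refine measurable_of_Iic fun x => ?_
  have hpre : (fun z : X × ℝ => quantile (κ z.1) z.2) ⁻¹' Iic x =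
      E ∩ {z | z.2 ≤ (κ z.1).real (Iic x)} ∪ Eᶜ ∩ {_z | 0 ≤ x} := by
    ext z
    by_cases hz : z ∈ E
    · simp [hz, quantile_of_mem x hz]
    · simp [hz, quantile_of_notMem hz]
  rw [hpre]
  exact (hE.inter (hm x)).union (hE.compl.inter (MeasurableSet.const _))

lemma measurable_quantile (η : Measure ℝ) [IsProbabilityMeasure η] : Measurable (quantile η) :=
  (measurable_quantile_kernel (Kernel.const Unit η)).comp (measurable_prodMk_left (x := ()))

lemma map_quantile (η : Measure ℝ) [IsProbabilityMeasure η] : lam.map (quantile η) = η := by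
  have := Measure.isProbabilityMeasure_map (μ := lam) (measurable_quantile η).aemeasurable
  refine Measure.ext_of_Iic _ _ fun x => ?_
  have hpre : quantile η ⁻¹' Iic x =ᵐ[lam] Iic (η.real (Iic x)) := by
    filter_upwards [ae_lam_mem] with u hu using propext (quantile_le_iff hu)
  rw [Measure.map_apply (measurable_quantile η) measurableSet_Iic, measure_congr hpre,
    lam_Iic measureReal_le_one, ofReal_measureReal]

lemma measurePreserving_quantile (η : Measure ℝ) [IsProbabilityMeasure η] :
    MeasurePreserving (quantile η) lam η :=
  ⟨measurable_quantile η, map_quantile η⟩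

lemma integral_id_map {X : Type*} [MeasurableSpace X] {ρ : Measure X} {f : X → ℝ}
    (hf : AEMeasurable f ρ) : ∫ w, w ∂(ρ.map f) = ∫ z, f z ∂ρ :=
  integral_map hf aestronglyMeasurable_id

lemma integral_quantile (η : Measure ℝ) [IsProbabilityMeasure η] :
    ∫ u, quantile η u ∂lam = ∫ w, w ∂η := by
  conv_rhs => rw [← map_quantile η]
  rw [integral_id_map (measurable_quantile η).aemeasurable]

lemma integrable_quantile (h : Integrable (fun w => w) η) : Integrable (quantile η) lam :=
  (measurePreserving_quantile η).integrable_comp_of_integrable h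

lemma stochLE_of_measure_le (h : ∀ x, η' (Iic x) ≤ η (Iic x)) : StochLE η η' := fun u hu => by
  rw [quantile_le_iff hu]
  exact ((quantile_le_iff hu).1 le_rfl).trans (ENNReal.toReal_mono (measure_ne_top _ _) (h _))

end Quantile

/-! ### Couplings and the Wasserstein distance on the line -/

namespace IsCoupling

variable {X Y E : Type*} [MeasurableSpace X] [MeasurableSpace Y] [NormedAddCommGroup E]
  {α : Measure X} {β : Measure Y} {χ : Measure (X × Y)}

lemma swap (hχ : IsCoupling α β χ) : IsCoupling β α (χ.map Prod.swap) := by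
  constructor
  · rw [Measure.map_map measurable_fst measurable_swap]; exact hχ.2
  · rw [Measure.map_map measurable_snd measurable_swap]; exact hχ.1

lemma of_map {Z : Type*} [MeasurableSpace Z] {ρ : Measure Z} {f : Z → X} {g : Z → Y}
    (hf : MeasurePreserving f ρ α) (hg : MeasurePreserving g ρ β) :
    IsCoupling α β (ρ.map fun z => (f z, g z)) := by
  constructor
  · rw [Measure.map_map measurable_fst (hf.measurable.prodMk hg.measurable)]; exact hf.map_eq
  · rw [Measure.map_map measurable_snd (hf.measurable.prodMk hg.measurable)]; exact hg.map_eq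

lemma measurePreserving_fst (hχ : IsCoupling α β χ) : MeasurePreserving Prod.fst χ α :=
  ⟨measurable_fst, hχ.1⟩

lemma measurePreserving_snd (hχ : IsCoupling α β χ) : MeasurePreserving Prod.snd χ β :=
  ⟨measurable_snd, hχ.2⟩

lemma ae_fst (hχ : IsCoupling α β χ) {P : X → Prop} (h : ∀ᵐ x ∂α, P x) : ∀ᵐ z ∂χ, P z.1 :=
  hχ.measurePreserving_fst.quasiMeasurePreserving.ae h

lemma ae_snd (hχ : IsCoupling α β χ) {P : Y → Prop} (h : ∀ᵐ y ∂β, P y) : ∀ᵐ z ∂χ, P z.2 :=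
  hχ.measurePreserving_snd.quasiMeasurePreserving.ae h

lemma integrable_fst (hχ : IsCoupling α β χ) {f : X → E} (hf : Integrable f α) :
    Integrable (fun z => f z.1) χ :=
  hχ.measurePreserving_fst.integrable_comp_of_integrable hf

lemma integrable_snd (hχ : IsCoupling α β χ) {f : Y → E} (hf : Integrable f β) :
    Integrable (fun z => f z.2) χ :=
  hχ.measurePreserving_snd.integrable_comp_of_integrable hf

lemma integral_fst [NormedSpace ℝ E] (hχ : IsCoupling α β χ) {f : X → E}
    (hf : AEStronglyMeasurable f α) : ∫ z, f z.1 ∂χ = ∫ x, f x ∂α := by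
  rw [← hχ.1, integral_map measurable_fst.aemeasurable (hχ.1.symm ▸ hf)]

lemma integral_snd [NormedSpace ℝ E] (hχ : IsCoupling α β χ) {f : Y → E}
    (hf : AEStronglyMeasurable f β) : ∫ z, f z.2 ∂χ = ∫ y, f y ∂β := by
  rw [← hχ.2, integral_map measurable_snd.aemeasurable (hχ.2.symm ▸ hf)]

end IsCoupling

lemma W1_comm (η η' : Measure ℝ) : W1 η η' = W1 η' η := by
  suffices h : ∀ ρ ρ' : Measure ℝ, W1 ρ ρ' ≤ W1 ρ' ρ from (h η η').antisymm (h η' η)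
  refine fun ρ ρ' => le_iInf₂ fun χ hχ => (iInf₂_le _ hχ.swap).trans_eq ?_
  rw [lintegral_map (by fun_prop) measurable_swap]
  simp only [Prod.fst_swap, Prod.snd_swap, abs_sub_comm]

section Wasserstein

variable {η η' : Measure ℝ}

lemma ofReal_abs_mean_sub_le_W1 (h : Integrable (fun w => w) η) (h' : Integrable (fun w => w) η') :
    ENNReal.ofReal |∫ w, w ∂η - ∫ w, w ∂η'| ≤ W1 η η' := by
  refine le_iInf₂ fun χ hχ => ?_
  rw [← hχ.integral_fst h.aestronglyMeasurable, ← hχ.integral_snd h'.aestronglyMeasurable,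
    ← integral_sub (hχ.integrable_fst h) (hχ.integrable_snd h')]
  simp only [← Real.enorm_eq_ofReal_abs]
  exact enorm_integral_le_lintegral_enorm _

variable [IsProbabilityMeasure η] [IsProbabilityMeasure η']

variable (η η') in
lemma W1_le_lintegral_quantile :
    W1 η η' ≤ ∫⁻ u, ENNReal.ofReal |quantile η u - quantile η' u| ∂lam := by
  have hχ := IsCoupling.of_map (measurePreserving_quantile η) (measurePreserving_quantile η')
  refine (iInf₂_le _ hχ).trans ?_
  rw [lintegral_map (by fun_prop) ((measurable_quantile η).prodMk (measurable_quantile η'))]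

variable (η) in
lemma W1_self : W1 η η = 0 :=
  le_antisymm ((W1_le_lintegral_quantile η η).trans (by simp)) zero_le

lemma W1_eq_of_stochLE (h : Integrable (fun w => w) η) (h' : Integrable (fun w => w) η')
    (hst : StochLE η η') : W1 η η' = ENNReal.ofReal |∫ w, w ∂η - ∫ w, w ∂η'| := by
  refine le_antisymm ((W1_le_lintegral_quantile η η').trans_eq ?_) (ofReal_abs_mean_sub_le_W1 h h')
  have hnonneg : ∀ᵐ u ∂lam, 0 ≤ quantile η' u - quantile η u := by
    filter_upwards [ae_lam_mem] with u hu using sub_nonneg.2 (hst u hu)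
  have hint : Integrable (fun u => quantile η' u - quantile η u) lam :=
    (integrable_quantile h').sub (integrable_quantile h)
  rw [← integral_quantile, ← integral_quantile, abs_sub_comm,
    ← integral_sub (integrable_quantile h') (integrable_quantile h),
    abs_of_nonneg (integral_nonneg_of_ae hnonneg), ofReal_integral_eq_lintegral_ofReal hint hnonneg]
  refine lintegral_congr_ae ?_
  filter_upwards [hnonneg] with u hu
  rw [abs_sub_comm, abs_of_nonneg hu]

end Wasserstein

/-! ### Lifts and the lifted adapted Wasserstein distance -/

lemma measurable_barycentre {X : Type*} [MeasurableSpace X] (κ : Kernel X ℝ) :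
    Measurable fun x => ∫ y, y ∂(κ x) :=
  (StronglyMeasurable.integral_kernel (κ := κ) stronglyMeasurable_id).measurable

lemma disint_compProd {X Ω : Type*} [MeasurableSpace X] [MeasurableSpace Ω] [StandardBorelSpace Ω]
    [Nonempty Ω] (α : Measure X) [IsFiniteMeasure α] (κ : Kernel X Ω) [IsMarkovKernel κ] :
    ∀ᵐ x ∂α, disint (α ⊗ₘ κ) x = κ x := by
  filter_upwards [condKernel_compProd α κ] with x hx
  rw [disint, dif_pos (inferInstanceAs (IsFiniteMeasure (α ⊗ₘ κ))), hx]

lemma disint_dirac_prod (x : ℝ) (η : Measure ℝ) [IsProbabilityMeasure η] :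
    disint ((Measure.dirac x).prod η) x = η := by
  have h := disint_compProd (Measure.dirac x) (Kernel.const ℝ η)
  rwa [ae_dirac_eq, Filter.eventually_pure, Measure.compProd_const, Kernel.const_apply] at h

lemma AW1_dirac_prod (x x' : ℝ) (η η' : Measure ℝ) [IsProbabilityMeasure η]
    [IsProbabilityMeasure η'] :
    AW1 ((Measure.dirac x).prod η) ((Measure.dirac x').prod η') =
      ENNReal.ofReal |x - x'| + W1 η η' := by
  have map_fst (x : ℝ) (η : Measure ℝ) [IsProbabilityMeasure η] :
      ((Measure.dirac x).prod η).map Prod.fst = Measure.dirac x := Measure.fst_prod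
  have cost_eq {χ : Measure (ℝ × ℝ)} (hχ : IsCoupling (Measure.dirac x) (Measure.dirac x') χ) :
      ∫⁻ z, (ENNReal.ofReal |z.1 - z.2| + W1 (disint ((Measure.dirac x).prod η) z.1)
        (disint ((Measure.dirac x').prod η') z.2)) ∂χ = ENNReal.ofReal |x - x'| + W1 η η' := by
    have hfst : ∀ᵐ z ∂χ, z.1 = x := hχ.ae_fst (P := (· = x)) (by simp [ae_dirac_eq])
    have hsnd : ∀ᵐ z ∂χ, z.2 = x' := hχ.ae_snd (P := (· = x')) (by simp [ae_dirac_eq])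
    have : IsProbabilityMeasure (χ.map Prod.fst) := hχ.1.symm ▸ inferInstance
    have : IsProbabilityMeasure χ := Measure.isProbabilityMeasure_of_map Prod.fst
    calc _ = ∫⁻ _, (ENNReal.ofReal |x - x'| + W1 η η') ∂χ := by
          refine lintegral_congr_ae ?_
          filter_upwards [hfst, hsnd] with z hz hz'
          rw [hz, hz', disint_dirac_prod, disint_dirac_prod]
      _ = _ := by rw [lintegral_const, measure_univ, mul_one]
  have hdirac : IsCoupling (Measure.dirac x) (Measure.dirac x') (Measure.dirac (x, x')) :=
    ⟨Measure.map_dirac' measurable_fst _, Measure.map_dirac' measurable_snd _⟩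
  rw [AW1, map_fst, map_fst]
  exact le_antisymm ((iInf₂_le _ hdirac).trans (cost_eq hdirac).le)
    (le_iInf₂ fun χ hχ => (cost_eq hχ).ge)

lemma ofReal_abs_mean_sub_le_AW1 {x x' : ℝ} {η η' : Measure ℝ} [IsProbabilityMeasure η]
    [IsProbabilityMeasure η'] (h : Integrable (fun w => w) η) (h' : Integrable (fun w => w) η')
    (hmean : ∫ w, w ∂η' = x') :
    ENNReal.ofReal |∫ w, w ∂η - x| ≤
      AW1 ((Measure.dirac x).prod η) ((Measure.dirac x').prod η') := by
  have htri : |∫ w, w ∂η - x| ≤ |x - x'| + |∫ w, w ∂η - ∫ w, w ∂η'| := by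
    rw [hmean, add_comm, abs_sub_comm x]
    exact abs_sub_le _ _ _
  calc ENNReal.ofReal |∫ w, w ∂η - x|
      ≤ ENNReal.ofReal |x - x'| + ENNReal.ofReal |∫ w, w ∂η - ∫ w, w ∂η'| := by
        rw [← ENNReal.ofReal_add (abs_nonneg _) (abs_nonneg _)]
        exact ENNReal.ofReal_le_ofReal htri
    _ ≤ AW1 ((Measure.dirac x).prod η) ((Measure.dirac x').prod η') := by
        rw [AW1_dirac_prod]
        gcongr
        exact ofReal_abs_mean_sub_le_W1 h h'

section Lift

variable {μ : Measure ℝ} [IsProbabilityMeasure μ]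

variable (μ) in
/-- The kernel `u ↦ δ_{F_μ⁻¹(u)} × p_u` of conditional laws of a lifted coupling given the level. -/
noncomputable def liftKernel (p : Kernel ℝ ℝ) : Kernel ℝ (ℝ × ℝ) :=
  Kernel.deterministic (quantile μ) (measurable_quantile μ) ×ₖ p

variable {p p' : Kernel ℝ ℝ} [IsMarkovKernel p] [IsMarkovKernel p']

instance : IsMarkovKernel (liftKernel μ p) := by unfold liftKernel; infer_instance

lemma liftKernel_apply (u : ℝ) :
    liftKernel μ p u = (Measure.dirac (quantile μ u)).prod (p u) := by
  rw [liftKernel, Kernel.prod_apply, Kernel.deterministic_apply]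

lemma lift_eq_compProd : lift μ p = lam ⊗ₘ liftKernel μ p := by
  rw [Measure.compProd_eq_comp_prod, lift]
  congr with u : 1
  rw [Kernel.prod_apply, Kernel.id_apply, liftKernel_apply]

lemma map_fst_lift : (lift μ p).map Prod.fst = lam := by
  rw [lift_eq_compProd]
  exact Measure.fst_compProd lam (liftKernel μ p)

lemma map_snd_lift : (lift μ p).map Prod.snd = lam.bind (liftKernel μ p) := by
  rw [lift_eq_compProd]
  exact Measure.snd_compProd lam (liftKernel μ p)

lemma isCoupling_map_snd_lift : IsCoupling μ (lam.bind p) ((lift μ p).map Prod.snd) := by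
  constructor
  · rw [map_snd_lift, Measure.map_comp _ _ measurable_fst, ← Kernel.fst_eq, liftKernel,
      Kernel.fst_prod, Measure.deterministic_comp_eq_map, map_quantile]
  · rw [map_snd_lift, Measure.map_comp _ _ measurable_snd, ← Kernel.snd_eq, liftKernel,
      Kernel.snd_prod]

lemma disint_lift : ∀ᵐ u ∂lam,
    disint (lift μ p) u = (Measure.dirac (quantile μ u)).prod (p u) := by
  simp only [lift_eq_compProd, ← liftKernel_apply]
  exact disint_compProd lam (liftKernel μ p)

lemma liftedAW1_lift_le_lintegral_W1 :
    liftedAW1 (lift μ p) (lift μ p') ≤ ∫⁻ u, W1 (p u) (p' u) ∂lam := by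
  have hdiag : MeasurableEmbedding fun u : ℝ => (u, u) :=
    (measurable_id.prodMk measurable_id).measurableEmbedding fun _ _ h => (Prod.ext_iff.1 h).1
  have hχ : IsCoupling ((lift μ p).map Prod.fst) ((lift μ p').map Prod.fst)
      (lam.map fun u => (u, u)) := by
    rw [map_fst_lift, map_fst_lift]
    exact IsCoupling.of_map (.id _) (.id _)
  refine (iInf₂_le _ hχ).trans_eq ?_
  rw [hdiag.lintegral_map]
  refine lintegral_congr_ae ?_
  filter_upwards [disint_lift (μ := μ) (p := p), disint_lift (μ := μ) (p := p')] with u hu hu'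
  rw [hu, hu', AW1_dirac_prod, sub_self, sub_self, abs_zero, ENNReal.ofReal_zero, zero_add,
    zero_add]

lemma lintegral_mean_sub_quantile_le_liftedAW1 {ν : Measure ℝ} {M' : Measure (ℝ × ℝ × ℝ)}
    (hp : ∀ᵐ u ∂lam, Integrable (fun y => y) (p u)) (hM' : IsLiftedMartingaleCoupling μ ν M') :
    ∫⁻ u, ENNReal.ofReal |∫ y, y ∂(p u) - quantile μ u| ∂lam ≤ liftedAW1 (lift μ p) M' := by
  obtain ⟨-, p', _, rfl, hp'⟩ := hM'
  refine le_iInf₂ fun χ hχ => ?_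
  rw [map_fst_lift, map_fst_lift] at hχ
  have hmeas : Measurable fun u => ENNReal.ofReal |∫ y, y ∂(p u) - quantile μ u| :=
    ((measurable_barycentre p).sub (measurable_quantile μ)).abs.ennreal_ofReal
  rw [← hχ.measurePreserving_fst.lintegral_comp hmeas]
  refine lintegral_mono_ae ?_
  filter_upwards [hχ.ae_fst (disint_lift (μ := μ) (p := p)), hχ.ae_fst hp,
    hχ.ae_snd (disint_lift (μ := μ) (p := p')), hχ.ae_snd hp'] with z hz hint hz' hmart
  rw [hz, hz']
  exact (ofReal_abs_mean_sub_le_AW1 hint hmart.1 hmart.2).trans le_add_self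

end Lift

section Rearrangement

variable {μ ν : Measure ℝ} [IsProbabilityMeasure μ] {p p' : Kernel ℝ ℝ} [IsMarkovKernel p]
  [IsMarkovKernel p']

lemma liftedAW1_eq_lintegral_of_W1_eq (hp : ∀ᵐ u ∂lam, Integrable (fun y => y) (p u))
    (hp' : IsLiftedMartingaleCoupling μ ν (lift μ p'))
    (hW : ∀ᵐ u ∂lam, W1 (p u) (p' u) = ENNReal.ofReal |∫ y, y ∂(p u) - quantile μ u|) :
    liftedAW1 (lift μ p) (lift μ p') = ∫⁻ u, W1 (p u) (p' u) ∂lam :=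
  liftedAW1_lift_le_lintegral_W1.antisymm
    ((lintegral_congr_ae hW).trans_le (lintegral_mean_sub_quantile_le_liftedAW1 hp hp'))

lemma isLiftedMartingaleRearrangement_of_W1_eq (hp : ∀ᵐ u ∂lam, Integrable (fun y => y) (p u))
    (hp' : IsLiftedMartingaleCoupling μ ν (lift μ p'))
    (hW : ∀ᵐ u ∂lam, W1 (p u) (p' u) = ENNReal.ofReal |∫ y, y ∂(p u) - quantile μ u|) :
    IsLiftedMartingaleRearrangement μ ν (lift μ p) (lift μ p') := by
  refine ⟨hp', le_antisymm (le_iInf₂ fun M' hM' => ?_) (iInf₂_le _ hp')⟩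
  rw [liftedAW1_eq_lintegral_of_W1_eq hp hp' hW, lintegral_congr_ae hW]
  exact lintegral_mean_sub_quantile_le_liftedAW1 hp hM'

end Rearrangement

section QuantileKernel

variable {X : Type*} [MeasurableSpace X] (μ : Measure ℝ) [IsProbabilityMeasure μ]

/-- The kernel `u ↦ κ_{F_μ⁻¹(u)}` of the lifted coupling `ι(μ × κ)`. -/
noncomputable def quantileKernel (κ : Kernel ℝ X) : Kernel ℝ X :=
  κ.comap (quantile μ) (measurable_quantile μ)

instance (κ : Kernel ℝ X) [IsMarkovKernel κ] : IsMarkovKernel (quantileKernel μ κ) := by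
  unfold quantileKernel; infer_instance

lemma quantileKernel_apply (κ : Kernel ℝ X) (u : ℝ) : quantileKernel μ κ u = κ (quantile μ u) := rfl

lemma iota_eq_lift (κ : Kernel ℝ ℝ) : iota μ κ = lift μ (quantileKernel μ κ) := rfl

lemma bind_quantileKernel (κ : Kernel ℝ X) : lam.bind (quantileKernel μ κ) = μ.bind κ := by
  conv_rhs => rw [← map_quantile μ, ← Measure.deterministic_comp_eq_map (measurable_quantile μ),
    Measure.comp_assoc, Kernel.comp_deterministic_eq_comap]
  rfl

lemma isLiftOf_iota (κ : Kernel ℝ ℝ) [IsMarkovKernel κ] : IsLiftOf μ (μ ⊗ₘ κ) (iota μ κ) := by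
  refine ⟨⟨quantileKernel μ κ, inferInstance, rfl⟩, ?_⟩
  have hker : liftKernel μ (quantileKernel μ κ) = quantileKernel μ (Kernel.id ×ₖ κ) := by
    ext u : 1
    rw [liftKernel_apply, quantileKernel_apply, quantileKernel_apply, Kernel.prod_apply,
      Kernel.id_apply]
  rw [iota_eq_lift, map_snd_lift, hker, bind_quantileKernel, Measure.compProd_eq_comp_prod]

end QuantileKernel

/-! ### First hitting times of the primitive of a nonincreasing function -/

section Hitting

variable {f : ℝ → ℝ} {a c k q : ℝ}

lemma intervalIntegrable_of_le (hf : IntervalIntegrable f volume a c) {s t : ℝ} (has : a ≤ s)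
    (hst : s ≤ t) (htc : t ≤ c) : IntervalIntegrable f volume s t :=
  hf.mono_set (uIcc_subset_uIcc (mem_uIcc_of_le has (hst.trans htc))
    (mem_uIcc_of_le (has.trans hst) htc))

lemma continuousOn_primitive (hac : a ≤ c) (hf : IntervalIntegrable f volume a c) :
    ContinuousOn (fun q => ∫ s in a..q, f s) (Icc a c) := by
  rw [← uIcc_of_le hac]
  exact intervalIntegral.continuousOn_primitive_interval' hf left_mem_uIcc

lemma exists_primitive_eq (haq : a ≤ q) (hf : IntervalIntegrable f volume a q) (hk : 0 ≤ k)
    (hkq : k ≤ ∫ s in a..q, f s) : ∃ r ∈ Icc a q, ∫ s in a..r, f s = k :=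
  intermediate_value_Icc haq (continuousOn_primitive haq hf)
    ⟨by rwa [intervalIntegral.integral_same], hkq⟩

lemma isLeast_hitting (hac : a ≤ c) (hf : IntervalIntegrable f volume a c) (hk : 0 ≤ k)
    (hkc : k ≤ ∫ s in a..c, f s) :
    IsLeast {q | q ∈ Icc a c ∧ ∫ s in a..q, f s = k}
      (sInf {q | q ∈ Icc a c ∧ ∫ s in a..q, f s = k}) := by
  have hbdd : BddBelow {q | q ∈ Icc a c ∧ ∫ s in a..q, f s = k} := ⟨a, fun q hq => hq.1.1⟩
  have hclosed : IsClosed {q | q ∈ Icc a c ∧ ∫ s in a..q, f s = k} :=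
    (continuousOn_primitive hac hf).preimage_isClosed_of_isClosed isClosed_Icc isClosed_singleton
  exact ⟨hclosed.csInf_mem (exists_primitive_eq hac hf hk hkc) hbdd, fun q hq => csInf_le hbdd hq⟩

lemma primitive_le_of_nonpos (hf : IntervalIntegrable f volume a c)
    (hanti : AntitoneOn f (Ioo a c)) {s : ℝ} (has : a < s) (hsq : s ≤ q) (hqc : q ≤ c)
    (hs : f s ≤ 0) : ∫ t in a..c, f t ≤ ∫ t in a..q, f t := by
  have hnonpos : ∫ t in q..c, f t ≤ 0 := by
    rw [intervalIntegral.integral_of_le hqc, integral_Ioc_eq_integral_Ioo]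
    refine setIntegral_nonpos measurableSet_Ioo fun t ht => ?_
    have hst := hsq.trans ht.1.le
    exact (hanti ⟨has, hst.trans_lt ht.2⟩ ⟨has.trans_le hst, ht.2⟩ hst).trans hs
  rw [← intervalIntegral.integral_add_adjacent_intervals
    (intervalIntegrable_of_le hf le_rfl (has.le.trans hsq) hqc)
    (intervalIntegrable_of_le hf (has.le.trans hsq) hqc le_rfl)]
  linarith

lemma nonneg_of_lt_hitting (hf : IntervalIntegrable f volume a c) (hanti : AntitoneOn f (Ioo a c))
    (hqc : q ≤ c) (hlt : ∫ s in a..q, f s < ∫ s in a..c, f s) {s : ℝ} (hs : s ∈ Ioo a q) :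
    0 ≤ f s := by
  by_contra! hneg
  exact hlt.not_ge (primitive_le_of_nonpos hf hanti hs.1 hs.2.le hqc hneg.le)

lemma hitting_le_iff (hac : a ≤ c) (hf : IntervalIntegrable f volume a c)
    (hanti : AntitoneOn f (Ioo a c)) (hk : 0 ≤ k) (hkc : k < ∫ s in a..c, f s)
    (hq : q ∈ Icc a c) :
    sInf {q | q ∈ Icc a c ∧ ∫ s in a..q, f s = k} ≤ q ↔ k ≤ ∫ s in a..q, f s := by
  obtain ⟨⟨hmem, hhit⟩, hleast⟩ := isLeast_hitting hac hf hk hkc.le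
  refine ⟨fun hle => ?_, fun hle => ?_⟩
  · by_contra! hlt
    have hnonneg := fun s hs => nonneg_of_lt_hitting hf hanti hq.2 (hlt.trans hkc) (s := s) hs
    refine hlt.not_ge ?_
    rw [← hhit, ← intervalIntegral.integral_add_adjacent_intervals
      (intervalIntegrable_of_le hf le_rfl hmem.1 hmem.2)
      (intervalIntegrable_of_le hf hmem.1 hle hq.2), le_add_iff_nonneg_right,
      intervalIntegral.integral_of_le hle, integral_Ioc_eq_integral_Ioo]
    exact setIntegral_nonneg measurableSet_Ioo fun t ht => hnonneg t ⟨hmem.1.trans_lt ht.1, ht.2⟩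
  · obtain ⟨r, hr, hr'⟩ := exists_primitive_eq hq.1
      (intervalIntegrable_of_le hf le_rfl hq.1 hq.2) hk hle
    exact (hleast ⟨⟨hr.1, hr.2.trans hq.2⟩, hr'⟩).trans hr.2

end Hitting

/-! ### The gap between upper and lower quantiles -/

/-- Gain in mean per unit of mass when the mass at level `s` from the bottom of `p η` is replaced
with the mass at level `s` from the top of `(1 - p) η'`. -/
noncomputable def gap (η η' : Measure ℝ) (p s : ℝ) : ℝ :=
  quantile η' (1 - s / (1 - p)) - quantile η (s / p)

section Gap

lemma div_mem_Ioo {s p : ℝ} (hs : s ∈ Ioo 0 p) : s / p ∈ Ioo (0 : ℝ) 1 :=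
  ⟨div_pos hs.1 (hs.1.trans hs.2), (div_lt_one (hs.1.trans hs.2)).2 hs.2⟩

lemma one_sub_mem_Ioo {t : ℝ} (ht : t ∈ Ioo (0 : ℝ) 1) : 1 - t ∈ Ioo (0 : ℝ) 1 :=
  ⟨sub_pos.2 ht.2, sub_lt_self 1 ht.1⟩

variable {η η' : Measure ℝ} [IsProbabilityMeasure η] [IsProbabilityMeasure η'] {p q c : ℝ}

lemma intervalIntegrable_quantile (h : Integrable (fun w => w) η) :
    IntervalIntegrable (quantile η) volume 0 1 :=
  (intervalIntegrable_iff_integrableOn_Ioo_of_le zero_le_one).2 (integrable_quantile h)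

variable (η) in
lemma intervalIntegral_quantile : ∫ u in (0 : ℝ)..1, quantile η u = ∫ w, w ∂η := by
  rw [← integral_quantile, intervalIntegral.integral_of_le zero_le_one, lam_eq_restrict_Ioc]

lemma intervalIntegrable_quantile_div (h : Integrable (fun w => w) η) (p : ℝ) :
    IntervalIntegrable (fun s => quantile η (s / p)) volume 0 p := by
  simpa [div_eq_inv_mul] using (intervalIntegrable_quantile h).comp_mul_left (c := p⁻¹)

lemma intervalIntegrable_quantile_one_sub_div (h : Integrable (fun w => w) η) (p : ℝ) :
    IntervalIntegrable (fun s => quantile η (1 - s / p)) volume 0 p := by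
  simpa [div_eq_inv_mul] using
    ((intervalIntegrable_quantile h).comp_sub_left 1).symm.comp_mul_left (c := p⁻¹)

lemma intervalIntegrable_gap (h : Integrable (fun w => w) η) (h' : Integrable (fun w => w) η')
    (hq : q ∈ Icc 0 (min p (1 - p))) : IntervalIntegrable (gap η η' p) volume 0 q :=
  (intervalIntegrable_of_le (intervalIntegrable_quantile_one_sub_div h' _) le_rfl hq.1
    (hq.2.trans (min_le_right _ _))).sub
    (intervalIntegrable_of_le (intervalIntegrable_quantile_div h _) le_rfl hq.1
      (hq.2.trans (min_le_left _ _)))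

variable (η η') in
lemma antitoneOn_gap (p : ℝ) : AntitoneOn (gap η η' p) (Ioo 0 (min p (1 - p))) := by
  intro s hs t ht hst
  have lt_left {r : ℝ} (hr : r ∈ Ioo 0 (min p (1 - p))) : r ∈ Ioo 0 p :=
    ⟨hr.1, hr.2.trans_le (min_le_left _ _)⟩
  have lt_right {r : ℝ} (hr : r ∈ Ioo 0 (min p (1 - p))) : r ∈ Ioo 0 (1 - p) :=
    ⟨hr.1, hr.2.trans_le (min_le_right _ _)⟩
  have hp : 0 ≤ p := (lt_left hs).1.le.trans (lt_left hs).2.le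
  have hp' : 0 ≤ 1 - p := (lt_right hs).1.le.trans (lt_right hs).2.le
  refine sub_le_sub
    (monotoneOn_quantile η' (one_sub_mem_Ioo (div_mem_Ioo (lt_right ht)))
      (one_sub_mem_Ioo (div_mem_Ioo (lt_right hs))) ?_)
    (monotoneOn_quantile η (div_mem_Ioo (lt_left hs)) (div_mem_Ioo (lt_left ht)) ?_)
  · gcongr
  · gcongr

lemma integral_quantile_div_le (h : Integrable (fun w => w) η) (hc : 0 < c) (hcp : c ≤ p) :
    ∫ s in (0 : ℝ)..c, quantile η (s / p) ≤ c * ∫ w, w ∂η := by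
  have hmean : c * ∫ w, w ∂η = ∫ s in (0 : ℝ)..c, quantile η (s / c) := by
    rw [intervalIntegral.integral_comp_div _ hc.ne', zero_div, div_self hc.ne',
      intervalIntegral_quantile, smul_eq_mul]
  rw [hmean]
  refine intervalIntegral.integral_mono_on_of_le_Ioo hc.le
    (intervalIntegrable_of_le (intervalIntegrable_quantile_div h _) le_rfl hc.le hcp)
    (intervalIntegrable_quantile_div h _) fun s hs => ?_
  exact monotoneOn_quantile η (div_mem_Ioo ⟨hs.1, hs.2.trans_le hcp⟩) (div_mem_Ioo hs)
    (div_le_div_of_nonneg_left hs.1.le hc hcp)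

lemma le_integral_quantile_one_sub_div (h : Integrable (fun w => w) η) (hc : 0 < c) (hcp : c ≤ p) :
    c * ∫ w, w ∂η ≤ ∫ s in (0 : ℝ)..c, quantile η (1 - s / p) := by
  have hmean : c * ∫ w, w ∂η = ∫ s in (0 : ℝ)..c, quantile η (1 - s / c) := by
    rw [intervalIntegral.integral_comp_sub_div _ hc.ne', zero_div, div_self hc.ne', sub_self,
      sub_zero, intervalIntegral_quantile, smul_eq_mul]
  rw [hmean]
  refine intervalIntegral.integral_mono_on_of_le_Ioo hc.le
    (intervalIntegrable_quantile_one_sub_div h _)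
    (intervalIntegrable_of_le (intervalIntegrable_quantile_one_sub_div h _) le_rfl hc.le hcp)
    fun s hs => ?_
  exact monotoneOn_quantile η (one_sub_mem_Ioo (div_mem_Ioo hs))
    (one_sub_mem_Ioo (div_mem_Ioo ⟨hs.1, hs.2.trans_le hcp⟩))
    (sub_le_sub_left (div_le_div_of_nonneg_left hs.1.le hc hcp) 1)

lemma integral_gap (h : Integrable (fun w => w) η) (h' : Integrable (fun w => w) η')
    (hq : q ∈ Icc 0 (min p (1 - p))) :
    ∫ s in (0 : ℝ)..q, gap η η' p s =
      (∫ s in (0 : ℝ)..q, quantile η' (1 - s / (1 - p))) - ∫ s in (0 : ℝ)..q, quantile η (s / p) :=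
  intervalIntegral.integral_sub
    (intervalIntegrable_of_le (intervalIntegrable_quantile_one_sub_div h' _) le_rfl hq.1
      (hq.2.trans (min_le_right _ _)))
    (intervalIntegrable_of_le (intervalIntegrable_quantile_div h _) le_rfl hq.1
      (hq.2.trans (min_le_left _ _)))

lemma mul_mean_sub_mean_le_integral_gap (h : Integrable (fun w => w) η)
    (h' : Integrable (fun w => w) η') (hp : 0 < min p (1 - p)) :
    min p (1 - p) * (∫ w, w ∂η' - ∫ w, w ∂η) ≤ ∫ s in (0 : ℝ)..(min p (1 - p)), gap η η' p s := by
  rw [integral_gap h h' ⟨hp.le, le_rfl⟩, mul_sub]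
  exact sub_le_sub (le_integral_quantile_one_sub_div h' hp (min_le_right _ _))
    (integral_quantile_div_le h hp (min_le_left _ _))

end Gap

/-! ### The amount of exchanged mass -/

/-- The law `η` of a quadruple `(y, y', η, η')`, as a Markov kernel. -/
noncomputable def lowerLaw : Kernel quadruples ℝ := ⟨fun b => b.1.2.2.1, by fun_prop⟩

/-- The law `η'` of a quadruple `(y, y', η, η')`, as a Markov kernel. -/
noncomputable def upperLaw : Kernel quadruples ℝ := ⟨fun b => b.1.2.2.2, by fun_prop⟩

instance : IsMarkovKernel lowerLaw := ⟨fun b => b.2.1.1⟩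

instance : IsMarkovKernel upperLaw := ⟨fun b => b.2.2.1.1⟩

/-- The increase in mean `p (y - x)` that exchanging mass has to produce. -/
noncomputable def gain (b : quadruples) : ℝ := weight b * (b.1.1 - ∫ w, w ∂lowerLaw b)

/-- The largest amount `min p (1 - p)` of mass that can be exchanged. -/
noncomputable def maxExchange (b : quadruples) : ℝ := min (weight b) (1 - weight b)

section Amount

variable (b : quadruples)

lemma integrable_lowerLaw : Integrable (fun w => w) (lowerLaw b) := b.2.1.2

lemma integrable_upperLaw : Integrable (fun w => w) (upperLaw b) := b.2.2.1.2

lemma mean_lowerLaw_lt : ∫ w, w ∂lowerLaw b < b.1.1 := b.2.2.2.1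

lemma fst_le_snd : b.1.1 ≤ b.1.2.1 := b.2.2.2.2.1

lemma lt_mean_upperLaw : b.1.2.1 < ∫ w, w ∂upperLaw b := b.2.2.2.2.2

lemma weight_eq : weight b = (∫ w, w ∂upperLaw b - b.1.2.1) /
    (b.1.1 - ∫ w, w ∂lowerLaw b + ∫ w, w ∂upperLaw b - b.1.2.1) := rfl

lemma mean_gap_pos : 0 < b.1.1 - ∫ w, w ∂lowerLaw b + ∫ w, w ∂upperLaw b - b.1.2.1 := by
  linarith [mean_lowerLaw_lt b, lt_mean_upperLaw b]

lemma weight_pos : 0 < weight b := by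
  rw [weight_eq]
  exact div_pos (sub_pos.2 (lt_mean_upperLaw b)) (mean_gap_pos b)

lemma one_sub_weight_pos : 0 < 1 - weight b := by
  rw [weight_eq, sub_pos, div_lt_one (mean_gap_pos b)]
  linarith [mean_lowerLaw_lt b]

lemma gain_eq : gain b = (1 - weight b) * (∫ w, w ∂upperLaw b - b.1.2.1) := by
  have hne := (mean_gap_pos b).ne'
  rw [gain, weight_eq]
  field_simp
  ring

lemma gain_pos : 0 < gain b := mul_pos (weight_pos b) (sub_pos.2 (mean_lowerLaw_lt b))

lemma maxExchange_pos : 0 < maxExchange b := lt_min (weight_pos b) (one_sub_weight_pos b)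

lemma gain_lt_integral_gap :
    gain b < ∫ s in (0 : ℝ)..maxExchange b, gap (lowerLaw b) (upperLaw b) (weight b) s := by
  have hlow := mean_lowerLaw_lt b
  have hmid := fst_le_snd b
  have hupp := lt_mean_upperLaw b
  refine lt_of_lt_of_le ?_ (mul_mean_sub_mean_le_integral_gap (integrable_lowerLaw b)
    (integrable_upperLaw b) (maxExchange_pos b))
  rw [min_mul_of_nonneg _ _ (by linarith)]
  refine lt_min ?_ ?_
  · rw [gain]
    exact mul_lt_mul_of_pos_left (by linarith) (weight_pos b)
  · rw [gain_eq]
    exact mul_lt_mul_of_pos_left (by linarith) (one_sub_weight_pos b)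

variable {b} {q : ℝ}

lemma mul_integral_eq_integral_comp_div (f : ℝ → ℝ) {c : ℝ} (hc : c ≠ 0) (q : ℝ) :
    c * ∫ u in (0 : ℝ)..(q / c), f u = ∫ s in (0 : ℝ)..q, f (s / c) := by
  rw [intervalIntegral.integral_comp_div _ hc, zero_div, smul_eq_mul]

variable (b q) in
lemma fnJ_eq : fnJ b q = (∫ u in (0 : ℝ)..(q / weight b),
      quantile (upperLaw b) ((1 - weight b * u - weight b) / (1 - weight b))) +
    ∫ u in (q / weight b)..1, quantile (lowerLaw b) u := rfl

variable (b q) in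
lemma fnJ'_eq : fnJ' b q = (∫ u in (0 : ℝ)..(q / (1 - weight b)),
      quantile (lowerLaw b) ((1 - weight b) * u / weight b)) +
    ∫ u in (0 : ℝ)..((1 - q - weight b) / (1 - weight b)), quantile (upperLaw b) u := rfl

lemma mul_fnJ (hq : q ∈ Icc 0 (maxExchange b)) :
    weight b * fnJ b q = weight b * ∫ w, w ∂lowerLaw b +
      ∫ s in (0 : ℝ)..q, gap (lowerLaw b) (upperLaw b) (weight b) s := by
  have hp := weight_pos b
  have hp' := (one_sub_weight_pos b).ne'
  have hr : q / weight b ∈ Icc (0 : ℝ) 1 :=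
    ⟨div_nonneg hq.1 hp.le, (div_le_one hp).2 (hq.2.trans (min_le_left _ _))⟩
  have hupper : weight b * ∫ u in (0 : ℝ)..(q / weight b),
      quantile (upperLaw b) ((1 - weight b * u - weight b) / (1 - weight b)) =
      ∫ s in (0 : ℝ)..q, quantile (upperLaw b) (1 - s / (1 - weight b)) := by
    rw [mul_integral_eq_integral_comp_div _ hp.ne']
    congr! 3
    field_simp
    ring
  have hI := intervalIntegrable_quantile (integrable_lowerLaw b)
  have hsplit := intervalIntegral.integral_add_adjacent_intervals
    (intervalIntegrable_of_le hI le_rfl hr.1 hr.2) (intervalIntegrable_of_le hI hr.1 hr.2 le_rfl)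
  rw [integral_gap (integrable_lowerLaw b) (integrable_upperLaw b) hq, ← hupper,
    ← mul_integral_eq_integral_comp_div _ hp.ne', ← intervalIntegral_quantile, ← hsplit, fnJ_eq]
  ring

lemma mul_fnJ' (hq : q ∈ Icc 0 (maxExchange b)) :
    (1 - weight b) * fnJ' b q = (1 - weight b) * ∫ w, w ∂upperLaw b -
      ∫ s in (0 : ℝ)..q, gap (lowerLaw b) (upperLaw b) (weight b) s := by
  have hp := one_sub_weight_pos b
  have hr : 1 - q / (1 - weight b) ∈ Icc (0 : ℝ) 1 :=
    ⟨sub_nonneg.2 ((div_le_one hp).2 (hq.2.trans (min_le_right _ _))),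
      sub_le_self 1 (div_nonneg hq.1 hp.le)⟩
  have hlower : (1 - weight b) * ∫ u in (0 : ℝ)..(q / (1 - weight b)),
      quantile (lowerLaw b) ((1 - weight b) * u / weight b) =
      ∫ s in (0 : ℝ)..q, quantile (lowerLaw b) (s / weight b) := by
    simp only [mul_integral_eq_integral_comp_div _ hp.ne', mul_div_cancel₀ _ hp.ne']
  have hupper : (1 - weight b) * ∫ u in (1 - q / (1 - weight b))..1, quantile (upperLaw b) u =
      ∫ s in (0 : ℝ)..q, quantile (upperLaw b) (1 - s / (1 - weight b)) := by
    rw [intervalIntegral.integral_comp_sub_div _ hp.ne', zero_div, sub_zero, smul_eq_mul]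
  have hI := intervalIntegrable_quantile (integrable_upperLaw b)
  have hsplit := intervalIntegral.integral_add_adjacent_intervals
    (intervalIntegrable_of_le hI le_rfl hr.1 hr.2) (intervalIntegrable_of_le hI hr.1 hr.2 le_rfl)
  have hend : (1 - q - weight b) / (1 - weight b) = 1 - q / (1 - weight b) := by
    field_simp
    ring
  rw [integral_gap (integrable_lowerLaw b) (integrable_upperLaw b) hq, ← hupper, ← hlower,
    ← intervalIntegral_quantile, ← hsplit, fnJ'_eq, hend]
  ring

variable (b)

lemma qStar_eq_sInf : qStar b = sInf {q | q ∈ Icc 0 (maxExchange b) ∧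
    ∫ s in (0 : ℝ)..q, gap (lowerLaw b) (upperLaw b) (weight b) s = gain b} := by
  rw [qStar]
  split_ifs with hp
  · have hIcc : Icc 0 (weight b) = Icc 0 (maxExchange b) :=
      congrArg (Icc 0) (min_eq_left (by linarith)).symm
    rw [hIcc]
    congr! 3 with q
    refine and_congr_right fun hq => ?_
    rw [← mul_right_inj' (weight_pos b).ne', mul_fnJ hq, gain, mul_sub, eq_sub_iff_add_eq']
  · have hIcc : Icc 0 (1 - weight b) = Icc 0 (maxExchange b) :=
      congrArg (Icc 0) (min_eq_right (by linarith)).symm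
    rw [hIcc]
    congr! 3 with q
    refine and_congr_right fun hq => ?_
    rw [← mul_right_inj' (one_sub_weight_pos b).ne', mul_fnJ' hq, gain_eq, mul_sub,
      sub_eq_iff_eq_add', eq_sub_iff_add_eq, eq_comm, add_comm]

lemma intervalIntegrable_gap_maxExchange :
    IntervalIntegrable (gap (lowerLaw b) (upperLaw b) (weight b)) volume 0 (maxExchange b) :=
  intervalIntegrable_gap (integrable_lowerLaw b) (integrable_upperLaw b)
    ⟨(maxExchange_pos b).le, le_rfl⟩

lemma qStar_mem_and_integral_gap : qStar b ∈ Icc 0 (maxExchange b) ∧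
    ∫ s in (0 : ℝ)..qStar b, gap (lowerLaw b) (upperLaw b) (weight b) s = gain b := by
  rw [qStar_eq_sInf]
  exact (isLeast_hitting (maxExchange_pos b).le (intervalIntegrable_gap_maxExchange b)
    (gain_pos b).le (gain_lt_integral_gap b).le).1

lemma qStar_nonneg : 0 ≤ qStar b := (qStar_mem_and_integral_gap b).1.1

lemma qStar_le_maxExchange : qStar b ≤ maxExchange b := (qStar_mem_and_integral_gap b).1.2

lemma qStar_le_weight : qStar b ≤ weight b := (qStar_le_maxExchange b).trans (min_le_left _ _)

lemma qStar_le_one_sub_weight : qStar b ≤ 1 - weight b :=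
  (qStar_le_maxExchange b).trans (min_le_right _ _)

lemma integral_gap_qStar :
    ∫ s in (0 : ℝ)..qStar b, gap (lowerLaw b) (upperLaw b) (weight b) s = gain b :=
  (qStar_mem_and_integral_gap b).2

variable {b}

lemma qStar_le_iff (hq : q ∈ Icc 0 (maxExchange b)) : qStar b ≤ q ↔
    gain b ≤ ∫ s in (0 : ℝ)..q, gap (lowerLaw b) (upperLaw b) (weight b) s := by
  rw [qStar_eq_sInf]
  exact hitting_le_iff (maxExchange_pos b).le (intervalIntegrable_gap_maxExchange b)
    (antitoneOn_gap _ _ _) (gain_pos b).le (gain_lt_integral_gap b) hq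

lemma gap_nonneg {s : ℝ} (hs : s ∈ Ioo 0 (qStar b)) :
    0 ≤ gap (lowerLaw b) (upperLaw b) (weight b) s :=
  nonneg_of_lt_hitting (intervalIntegrable_gap_maxExchange b) (antitoneOn_gap _ _ _)
    (qStar_le_maxExchange b) ((integral_gap_qStar b).trans_lt (gain_lt_integral_gap b)) hs

end Amount

/-! ### Measurability of the explicit exchange maps -/

section Measurability

lemma measurable_weight : Measurable fun b : quadruples => weight b := by
  have hlower := measurable_barycentre lowerLaw
  have hupper := measurable_barycentre upperLaw
  simp only [weight_eq]
  fun_prop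

lemma measurable_gain : Measurable gain := by
  have hlower := measurable_barycentre lowerLaw
  have hweight := measurable_weight
  unfold gain
  fun_prop

lemma measurable_maxExchange : Measurable maxExchange :=
  measurable_weight.min (measurable_const.sub measurable_weight)

lemma measurable_quantile_comp {X Y : Type*} [MeasurableSpace X] [MeasurableSpace Y]
    (κ : Kernel X ℝ) [IsMarkovKernel κ] {f : Y → X} {g : Y → ℝ} (hf : Measurable f)
    (hg : Measurable g) : Measurable fun y => quantile (κ (f y)) (g y) :=
  (measurable_quantile_kernel κ).comp (hf.prodMk hg)

lemma measurable_integral_gap {q : quadruples → ℝ} (hq : Measurable q) (hq0 : ∀ b, 0 ≤ q b) :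
    Measurable fun b : quadruples =>
      ∫ s in (0 : ℝ)..q b, gap (lowerLaw b) (upperLaw b) (weight b) s := by
  have hweight : Measurable fun z : quadruples × ℝ => weight z.1 :=
    measurable_weight.comp measurable_fst
  have hgap : Measurable fun z : quadruples × ℝ =>
      gap (lowerLaw z.1) (upperLaw z.1) (weight z.1) z.2 :=
    (measurable_quantile_comp upperLaw measurable_fst (by fun_prop)).sub
      (measurable_quantile_comp lowerLaw measurable_fst (by fun_prop))
  have hset : MeasurableSet {z : quadruples × ℝ | z.2 ∈ Ioc 0 (q z.1)} :=
    (measurableSet_lt measurable_const measurable_snd).inter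
      (measurableSet_le measurable_snd (hq.comp measurable_fst))
  convert ((hgap.indicator hset).stronglyMeasurable.integral_prod_right'
    (ν := volume)).measurable using 2 with b
  rw [intervalIntegral.integral_of_le (hq0 b), ← integral_indicator measurableSet_Ioc]
  rfl

lemma measurable_qStar : Measurable fun b : quadruples => qStar b := by
  refine measurable_of_Iic fun t => ?_
  rcases lt_or_ge t 0 with ht | ht
  · convert MeasurableSet.empty
    exact eq_empty_of_forall_notMem fun b hb => ht.not_ge ((qStar_nonneg b).trans hb)
  · have hmem (b : quadruples) : min t (maxExchange b) ∈ Icc 0 (maxExchange b) :=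
      ⟨le_min ht (maxExchange_pos b).le, min_le_right _ _⟩
    convert measurableSet_le measurable_gain (measurable_integral_gap
      (measurable_const.min measurable_maxExchange) fun b => (hmem b).1) using 1
    ext b
    rw [mem_ofPred_eq, ← qStar_le_iff (hmem b), le_min_iff]
    exact ⟨fun h => ⟨h, qStar_le_maxExchange b⟩, And.left⟩

/-- The map whose image of Lebesgue measure on `(0,1)` is `exchangeFst`. -/
noncomputable def exchangeFstMap (b : quadruples) (u : ℝ) : ℝ :=
  if u < qStar b / weight b then
    quantile (upperLaw b) ((1 - weight b * u - weight b) / (1 - weight b))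
  else quantile (lowerLaw b) u

/-- The map whose image of Lebesgue measure on `(0,1)` is `exchangeSnd`. -/
noncomputable def exchangeSndMap (b : quadruples) (u : ℝ) : ℝ :=
  if u < qStar b / (1 - weight b) then quantile (lowerLaw b) ((1 - weight b) * u / weight b)
  else quantile (upperLaw b) (u - qStar b / (1 - weight b))

lemma exchangeFst_eq_map (b : quadruples) : exchangeFst b = lam.map (exchangeFstMap b) := rfl

lemma exchangeSnd_eq_map (b : quadruples) : exchangeSnd b = lam.map (exchangeSndMap b) := rfl

lemma measurable_uncurry_exchangeFstMap : Measurable (Function.uncurry exchangeFstMap) := by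
  have hweight : Measurable fun z : quadruples × ℝ => weight z.1 :=
    measurable_weight.comp measurable_fst
  have hqStar : Measurable fun z : quadruples × ℝ => qStar z.1 :=
    measurable_qStar.comp measurable_fst
  exact Measurable.ite (measurableSet_lt measurable_snd (by fun_prop))
    (measurable_quantile_comp upperLaw measurable_fst (by fun_prop))
    (measurable_quantile_comp lowerLaw measurable_fst measurable_snd)

lemma measurable_uncurry_exchangeSndMap : Measurable (Function.uncurry exchangeSndMap) := by
  have hweight : Measurable fun z : quadruples × ℝ => weight z.1 :=
    measurable_weight.comp measurable_fst
  have hqStar : Measurable fun z : quadruples × ℝ => qStar z.1 :=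
    measurable_qStar.comp measurable_fst
  exact Measurable.ite (measurableSet_lt measurable_snd (by fun_prop))
    (measurable_quantile_comp lowerLaw measurable_fst (by fun_prop))
    (measurable_quantile_comp upperLaw measurable_fst (by fun_prop))

lemma measurable_exchangeFstMap (b : quadruples) : Measurable (exchangeFstMap b) :=
  measurable_uncurry_exchangeFstMap.of_uncurry_left

lemma measurable_exchangeSndMap (b : quadruples) : Measurable (exchangeSndMap b) :=
  measurable_uncurry_exchangeSndMap.of_uncurry_left

lemma measurable_map_of_measurable_uncurry {X Y Z : Type*} [MeasurableSpace X] [MeasurableSpace Y]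
    [MeasurableSpace Z] {ρ : Measure Y} [SFinite ρ] {F : X → Y → Z}
    (hF : Measurable (Function.uncurry F)) : Measurable fun x => ρ.map (F x) := by
  refine Measure.measurable_measure.2 fun S hS => ?_
  simp only [Measure.map_apply hF.of_uncurry_left hS]
  exact measurable_measure_prodMk_left (hF hS)

lemma measurable_exchangeFst : Measurable fun b : quadruples => exchangeFst b :=
  measurable_map_of_measurable_uncurry measurable_uncurry_exchangeFstMap

lemma measurable_exchangeSnd : Measurable fun b : quadruples => exchangeSnd b :=
  measurable_map_of_measurable_uncurry measurable_uncurry_exchangeSndMap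

end Measurability

/-! ### The laws of the explicit exchange maps -/

section Levels

variable {f g h : ℝ → ℝ} {a q : ℝ}

lemma smul_map_lam (hf : Measurable f) (ha : 0 < a) :
    ENNReal.ofReal a • lam.map f = (volume.restrict (Ico 0 a)).map fun s => f (s / a) := by
  have hf' : Measurable fun s => f (s / a) := hf.comp (measurable_id.div_const a)
  rw [lam_eq_restrict_Ioc, ← restrict_Ico_eq_restrict_Ioc]
  ext S hS
  have hpre : (fun s => f (s / a)) ⁻¹' S ∩ Ico 0 a =
      (fun s => a⁻¹ * s) ⁻¹' (f ⁻¹' S ∩ Ico 0 1) := by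
    ext s
    simp only [mem_inter_iff, mem_preimage, mem_Ico, ← div_eq_inv_mul, div_lt_one ha,
      le_div_iff₀ ha, zero_mul]
  rw [Measure.smul_apply, Measure.map_apply hf hS, Measure.map_apply hf' hS,
    Measure.restrict_apply (hf hS), Measure.restrict_apply (hf' hS), smul_eq_mul, hpre,
    Real.volume_preimage_mul_left (inv_ne_zero ha.ne'), inv_inv, abs_of_pos ha]

lemma map_ite_restrict_Ico (hg : Measurable g) (hh : Measurable h) (hq : 0 ≤ q) (hqa : q ≤ a) :
    (volume.restrict (Ico 0 a)).map (fun s => if s < q then g s else h s) =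
      (volume.restrict (Ico 0 q)).map g + (volume.restrict (Ico q a)).map h := by
  rw [← Ico_union_Ico_eq_Ico hq hqa, Measure.restrict_union
    Ico_disjoint_Ico_same measurableSet_Ico,
    Measure.map_add _ _ (Measurable.ite measurableSet_Iio hg hh)]
  congr 1 <;> refine Measure.map_congr ?_
  · filter_upwards [ae_restrict_mem measurableSet_Ico] with s hs using if_pos hs.2
  · filter_upwards [ae_restrict_mem measurableSet_Ico] with s hs using if_neg hs.1.not_gt

lemma map_restrict_Ico_add (hh : Measurable h) (hq : 0 ≤ q) (hqa : q ≤ a) :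
    (volume.restrict (Ico 0 q)).map h + (volume.restrict (Ico q a)).map h =
      (volume.restrict (Ico 0 a)).map h := by
  rw [← map_ite_restrict_Ico hh hh hq hqa]
  simp only [ite_self]

lemma map_const_sub_restrict_Ico (hh : Measurable h) (t a c : ℝ) :
    (volume.restrict (Ico a c)).map (fun s => h (t - s)) =
      (volume.restrict (Ico (t - c) (t - a))).map h := by
  have hmp := (Measure.measurePreserving_sub_left (volume : Measure ℝ) t).restrict_preimage
    (measurableSet_Ioc (a := t - c) (b := t - a))
  rw [preimage_const_sub_Ioc, sub_sub_cancel, sub_sub_cancel, ← restrict_Ico_eq_restrict_Ioc] at hmp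
  rw [← hmp.map_eq, Measure.map_map hh hmp.measurable]
  rfl

end Levels

section Laws

variable (b : quadruples)

lemma measurable_quantile_lowerLaw_div :
    Measurable fun s => quantile (lowerLaw b) (s / weight b) :=
  (measurable_quantile _).comp (measurable_id.div_const _)

lemma measurable_quantile_upperLaw_one_sub_div :
    Measurable fun s => quantile (upperLaw b) (1 - s / (1 - weight b)) :=
  (measurable_quantile _).comp (measurable_const.sub (measurable_id.div_const _))

lemma smul_lowerLaw : ENNReal.ofReal (weight b) • lowerLaw b =
    (volume.restrict (Ico 0 (weight b))).map fun s => quantile (lowerLaw b) (s / weight b) := by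
  rw [← smul_map_lam (measurable_quantile _) (weight_pos b), map_quantile]

lemma smul_upperLaw : ENNReal.ofReal (1 - weight b) • upperLaw b =
    (volume.restrict (Ico 0 (1 - weight b))).map
      fun s => quantile (upperLaw b) (1 - s / (1 - weight b)) := by
  have hp := one_sub_weight_pos b
  have hrefl := map_const_sub_restrict_Ico (measurable_quantile_upperLaw_one_sub_div b)
    (1 - weight b) 0 (1 - weight b)
  rw [sub_self, sub_zero] at hrefl
  nth_rewrite 1 [← hrefl, ← map_quantile (upperLaw b)]
  rw [smul_map_lam (measurable_quantile _) hp]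
  congr! 3
  field_simp
  ring

instance isProbabilityMeasure_exchangeFst : IsProbabilityMeasure (exchangeFst b) :=
  Measure.isProbabilityMeasure_map (measurable_exchangeFstMap b).aemeasurable

instance isProbabilityMeasure_exchangeSnd : IsProbabilityMeasure (exchangeSnd b) :=
  Measure.isProbabilityMeasure_map (measurable_exchangeSndMap b).aemeasurable

lemma exchangeFstMap_eq (u : ℝ) : exchangeFstMap b u = if u < qStar b / weight b then
    quantile (upperLaw b) (1 - weight b * u / (1 - weight b)) else quantile (lowerLaw b) u := by
  have hp := (one_sub_weight_pos b).ne'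
  rw [exchangeFstMap]
  congr 2
  field_simp
  ring

lemma exchangeSndMap_eq (u : ℝ) : exchangeSndMap b u = if u < qStar b / (1 - weight b) then
    quantile (lowerLaw b) ((1 - weight b) * u / weight b)
    else quantile (upperLaw b)
      (1 - (1 - weight b + qStar b - (1 - weight b) * u) / (1 - weight b)) := by
  have hp := (one_sub_weight_pos b).ne'
  rw [exchangeSndMap]
  congr 2
  field_simp
  ring

lemma smul_exchangeFst : ENNReal.ofReal (weight b) • exchangeFst b =
    (volume.restrict (Ico 0 (qStar b))).map
        (fun s => quantile (upperLaw b) (1 - s / (1 - weight b))) +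
      (volume.restrict (Ico (qStar b) (weight b))).map
        (fun s => quantile (lowerLaw b) (s / weight b)) := by
  have hp := weight_pos b
  rw [exchangeFst_eq_map, smul_map_lam (measurable_exchangeFstMap b) hp,
    ← map_ite_restrict_Ico (measurable_quantile_upperLaw_one_sub_div b)
      (measurable_quantile_lowerLaw_div b) (qStar_nonneg b) (qStar_le_weight b)]
  simp only [exchangeFstMap_eq, div_lt_div_iff_of_pos_right hp, mul_div_cancel₀ _ hp.ne']

lemma smul_exchangeSnd : ENNReal.ofReal (1 - weight b) • exchangeSnd b =
    (volume.restrict (Ico 0 (qStar b))).map (fun s => quantile (lowerLaw b) (s / weight b)) +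
      (volume.restrict (Ico (qStar b) (1 - weight b))).map
        (fun s => quantile (upperLaw b) (1 - s / (1 - weight b))) := by
  have hp := one_sub_weight_pos b
  have hupper := measurable_quantile_upperLaw_one_sub_div b
  have hrefl := map_const_sub_restrict_Ico hupper (1 - weight b + qStar b) (qStar b) (1 - weight b)
  have hupper' : Measurable fun s =>
      quantile (upperLaw b) (1 - (1 - weight b + qStar b - s) / (1 - weight b)) :=
    hupper.comp (measurable_id.const_sub _)
  rw [add_sub_cancel_left, add_sub_cancel_right] at hrefl
  rw [← hrefl, exchangeSnd_eq_map, smul_map_lam (measurable_exchangeSndMap b) hp,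
    ← map_ite_restrict_Ico (measurable_quantile_lowerLaw_div b) hupper' (qStar_nonneg b)
      (qStar_le_one_sub_weight b)]
  simp only [exchangeSndMap_eq, div_lt_div_iff_of_pos_right hp, mul_div_cancel₀ _ hp.ne']

lemma exchange_mixture :
    ENNReal.ofReal (weight b) • exchangeFst b + ENNReal.ofReal (1 - weight b) • exchangeSnd b =
      ENNReal.ofReal (weight b) • lowerLaw b + ENNReal.ofReal (1 - weight b) • upperLaw b := by
  rw [smul_exchangeFst, smul_exchangeSnd, smul_lowerLaw, smul_upperLaw,
    ← map_restrict_Ico_add (measurable_quantile_lowerLaw_div b) (qStar_nonneg b)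
      (qStar_le_weight b),
    ← map_restrict_Ico_add (measurable_quantile_upperLaw_one_sub_div b) (qStar_nonneg b)
      (qStar_le_one_sub_weight b)]
  abel

lemma quantile_lowerLaw_le_exchangeFstMap {u : ℝ} (hu : 0 < u) :
    quantile (lowerLaw b) u ≤ exchangeFstMap b u := by
  have hp := weight_pos b
  rw [exchangeFstMap_eq]
  split_ifs with hlt
  · have hgap := gap_nonneg (b := b) (s := weight b * u)
      ⟨mul_pos hp hu, by rwa [lt_div_iff₀' hp] at hlt⟩
    rwa [gap, mul_div_cancel_left₀ _ hp.ne', sub_nonneg] at hgap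
  · exact le_rfl

lemma exchangeFst_Iic_le (x : ℝ) : exchangeFst b (Iic x) ≤ lowerLaw b (Iic x) := by
  rw [← map_quantile (lowerLaw b), exchangeFst_eq_map,
    Measure.map_apply (measurable_exchangeFstMap b) measurableSet_Iic,
    Measure.map_apply (measurable_quantile _) measurableSet_Iic]
  refine measure_mono_ae ?_
  filter_upwards [ae_lam_mem] with u hu hle
  exact (quantile_lowerLaw_le_exchangeFstMap b hu.1).trans hle

end Laws

section Mixture

variable {β β' η η' : Measure ℝ} {a a' : ENNReal}

lemma integrable_of_mixture (hmix : a • β + a' • β' = a • η + a' • η') (ha : a ≠ 0) (ha' : a ≠ ⊤)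
    (hb : a' ≠ ⊤) (h : Integrable (fun w => w) η) (h' : Integrable (fun w => w) η') :
    Integrable (fun w => w) β := by
  have hsum : Integrable (fun w => w) (a • β + a' • β') :=
    hmix ▸ (h.smul_measure ha').add_measure (h'.smul_measure hb)
  exact (integrable_smul_measure ha ha').1 (integrable_add_measure.1 hsum).1

lemma mean_of_mixture (hmix : a • β + a' • β' = a • η + a' • η') (ha : a ≠ ⊤) (ha' : a' ≠ ⊤)
    (hβ : Integrable (fun w => w) β) (hβ' : Integrable (fun w => w) β')
    (hη : Integrable (fun w => w) η) (hη' : Integrable (fun w => w) η') :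
    a.toReal * ∫ w, w ∂β + a'.toReal * ∫ w, w ∂β' =
      a.toReal * ∫ w, w ∂η + a'.toReal * ∫ w, w ∂η' := by
  have hmean := congrArg (fun ρ : Measure ℝ => ∫ w, w ∂ρ) hmix
  simpa only [integral_add_measure (hβ.smul_measure ha) (hβ'.smul_measure ha'),
    integral_add_measure (hη.smul_measure ha) (hη'.smul_measure ha'), integral_smul_measure,
    smul_eq_mul] using hmean

lemma measure_le_of_mixture [IsFiniteMeasure β] (hmix : a • β + a' • β' = a • η + a' • η')
    (ha : a ≠ ⊤) (ha' : a' ≠ 0) (hb' : a' ≠ ⊤) {S : Set ℝ} (hle : β S ≤ η S) : η' S ≤ β' S := by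
  have hS := congrArg (fun ρ : Measure ℝ => ρ S) hmix
  simp only [Measure.add_apply, Measure.smul_apply, smul_eq_mul] at hS
  rw [← ENNReal.mul_le_mul_iff_right ha' hb',
    ← ENNReal.add_le_add_iff_left (ENNReal.mul_ne_top ha (measure_ne_top β S)), hS]
  gcongr

end Mixture

section Exchange

variable (b : quadruples)

lemma integrable_exchangeFst : Integrable (fun w => w) (exchangeFst b) :=
  integrable_of_mixture (exchange_mixture b) (ENNReal.ofReal_pos.2 (weight_pos b)).ne'
    ENNReal.ofReal_ne_top ENNReal.ofReal_ne_top (integrable_lowerLaw b) (integrable_upperLaw b)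

lemma integrable_exchangeSnd : Integrable (fun w => w) (exchangeSnd b) := by
  have hmix := exchange_mixture b
  rw [add_comm, add_comm (_ • lowerLaw b)] at hmix
  exact integrable_of_mixture hmix (ENNReal.ofReal_pos.2 (one_sub_weight_pos b)).ne'
    ENNReal.ofReal_ne_top ENNReal.ofReal_ne_top (integrable_upperLaw b) (integrable_lowerLaw b)

lemma mean_exchangeFst_eq_fnJ : ∫ w, w ∂exchangeFst b = fnJ b (qStar b) := by
  have hp := weight_pos b
  have hr : qStar b / weight b ∈ Icc (0 : ℝ) 1 :=
    ⟨div_nonneg (qStar_nonneg b) hp.le, (div_le_one hp).2 (qStar_le_weight b)⟩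
  have hmap := (measurable_exchangeFstMap b).aemeasurable (μ := lam)
  have hI : IntervalIntegrable (exchangeFstMap b) volume 0 1 :=
    (intervalIntegrable_iff_integrableOn_Ioo_of_le zero_le_one).2
      ((integrable_map_measure aestronglyMeasurable_id hmap).1 (integrable_exchangeFst b))
  rw [exchangeFst_eq_map, integral_id_map hmap, lam_eq_restrict_Ioc,
    ← intervalIntegral.integral_of_le zero_le_one,
    ← intervalIntegral.integral_add_adjacent_intervals
      (intervalIntegrable_of_le hI le_rfl hr.1 hr.2) (intervalIntegrable_of_le hI hr.1 hr.2 le_rfl)]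
  congr 1
  · exact intervalIntegral.integral_congr_Ioo_of_le hr.1 fun u hu => if_pos hu.2
  · exact intervalIntegral.integral_congr_Ioo_of_le hr.2 fun u hu => if_neg hu.1.not_gt

lemma mean_exchangeFst : ∫ w, w ∂exchangeFst b = b.1.1 := by
  rw [mean_exchangeFst_eq_fnJ, ← mul_right_inj' (weight_pos b).ne',
    mul_fnJ ⟨qStar_nonneg b, qStar_le_maxExchange b⟩, integral_gap_qStar, gain]
  ring

lemma mean_exchangeSnd : ∫ w, w ∂exchangeSnd b = b.1.2.1 := by
  have hmean := mean_of_mixture (exchange_mixture b) ENNReal.ofReal_ne_top ENNReal.ofReal_ne_top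
    (integrable_exchangeFst b) (integrable_exchangeSnd b) (integrable_lowerLaw b)
    (integrable_upperLaw b)
  rw [ENNReal.toReal_ofReal (weight_pos b).le, ENNReal.toReal_ofReal (one_sub_weight_pos b).le,
    mean_exchangeFst] at hmean
  have hgain := gain_eq b
  rw [gain] at hgain
  rw [← mul_right_inj' (one_sub_weight_pos b).ne']
  linarith

lemma stochLE_exchangeFst : StochLE (lowerLaw b) (exchangeFst b) :=
  stochLE_of_measure_le (exchangeFst_Iic_le b)

lemma stochLE_exchangeSnd : StochLE (exchangeSnd b) (upperLaw b) :=
  stochLE_of_measure_le fun x => measure_le_of_mixture (exchange_mixture b) ENNReal.ofReal_ne_top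
    (ENNReal.ofReal_pos.2 (one_sub_weight_pos b)).ne' ENNReal.ofReal_ne_top
    (exchangeFst_Iic_le b x)

end Exchange

theorem isExchange_exchangeFst_exchangeSnd : IsExchange exchangeFst exchangeSnd where
  measurable_fst := measurable_exchangeFst
  measurable_snd := measurable_exchangeSnd
  isP1_fst b hb := ⟨isProbabilityMeasure_exchangeFst ⟨b, hb⟩, integrable_exchangeFst ⟨b, hb⟩⟩
  isP1_snd b hb := ⟨isProbabilityMeasure_exchangeSnd ⟨b, hb⟩, integrable_exchangeSnd ⟨b, hb⟩⟩
  mean_fst b hb := mean_exchangeFst ⟨b, hb⟩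
  mean_snd b hb := mean_exchangeSnd ⟨b, hb⟩
  stochLE_fst b hb := stochLE_exchangeFst ⟨b, hb⟩
  stochLE_snd b hb := stochLE_exchangeSnd ⟨b, hb⟩
  mixture b hb := exchange_mixture ⟨b, hb⟩

/-! ### Monotone transport between densities on the unit interval -/

section GenInv

variable {D : ℝ → ℝ} {v r : ℝ}

lemma bddBelow_setOf_mem_Icc_le (D : ℝ → ℝ) (v : ℝ) :
    BddBelow {r | r ∈ Icc (0 : ℝ) 1 ∧ v ≤ D r} :=
  ⟨0, fun _ hr => hr.1.1⟩

lemma genInv_le (hr : r ∈ Icc (0 : ℝ) 1) (hv : v ≤ D r) : genInv D v ≤ r :=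
  csInf_le (bddBelow_setOf_mem_Icc_le D v) ⟨hr, hv⟩

lemma genInv_eq_zero_of_forall_lt (hv : ∀ r ∈ Icc (0 : ℝ) 1, D r < v) : genInv D v = 0 := by
  have hempty : {r | r ∈ Icc (0 : ℝ) 1 ∧ v ≤ D r} = ∅ :=
    eq_empty_of_forall_notMem fun r hr => (hv r hr.1).not_ge hr.2
  rw [genInv, hempty, Real.sInf_empty]

lemma genInv_mem_Icc (D : ℝ → ℝ) (v : ℝ) : genInv D v ∈ Icc (0 : ℝ) 1 := by
  refine ⟨Real.sInf_nonneg fun _ hr => hr.1.1, ?_⟩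
  by_cases hv : ∃ r ∈ Icc (0 : ℝ) 1, v ≤ D r
  · obtain ⟨r, hr, hvr⟩ := hv
    exact (genInv_le hr hvr).trans hr.2
  · push Not at hv
    exact (genInv_eq_zero_of_forall_lt hv).trans_le zero_le_one

lemma monotoneOn_genInv (D : ℝ → ℝ) : MonotoneOn (genInv D) (Iic (D 1)) :=
  fun v _ _ hw hvw => csInf_le_csInf (bddBelow_setOf_mem_Icc_le D v)
    ⟨1, right_mem_Icc.2 zero_le_one, hw⟩ fun _ hr => ⟨hr.1, hvw.trans hr.2⟩

lemma measurable_genInv (hD : MonotoneOn D (Icc 0 1)) : Measurable (genInv D) := by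
  have hmono : Monotone fun v => genInv D (min v (D 1)) := fun v w hvw =>
    monotoneOn_genInv D (min_le_right v _) (min_le_right w _) (min_le_min_right _ hvw)
  have hite : genInv D = fun v => if v ≤ D 1 then genInv D (min v (D 1)) else 0 := by
    funext v
    split_ifs with hv
    · rw [min_eq_left hv]
    · exact genInv_eq_zero_of_forall_lt fun r hr =>
        (hD hr (right_mem_Icc.2 zero_le_one) hr.2).trans_lt (not_le.1 hv)
  rw [hite]
  exact hmono.measurable.ite measurableSet_Iic measurable_const

lemma isLeast_genInv (hD : ContinuousOn D (Icc 0 1)) (hv : v ≤ D 1) :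
    IsLeast {r | r ∈ Icc (0 : ℝ) 1 ∧ v ≤ D r} (genInv D v) :=
  ⟨(hD.preimage_isClosed_of_isClosed isClosed_Icc isClosed_Ici).csInf_mem
    ⟨1, right_mem_Icc.2 zero_le_one, hv⟩ (bddBelow_setOf_mem_Icc_le D v),
    fun _ hr => genInv_le hr.1 hr.2⟩

lemma genInv_le_iff (hD : ContinuousOn D (Icc 0 1)) (hmono : MonotoneOn D (Icc 0 1))
    (hv : v ≤ D 1) (hr : r ∈ Icc (0 : ℝ) 1) : genInv D v ≤ r ↔ v ≤ D r :=
  ⟨fun h => (isLeast_genInv hD hv).1.2.trans (hmono (genInv_mem_Icc D v) hr h), genInv_le hr⟩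

lemma apply_genInv (hD : ContinuousOn D (Icc 0 1)) (hmono : MonotoneOn D (Icc 0 1))
    (hv : v ∈ Icc (D 0) (D 1)) : D (genInv D v) = v := by
  obtain ⟨r, hr, rfl⟩ := intermediate_value_Icc zero_le_one hD hv
  exact le_antisymm (hmono (genInv_mem_Icc D _) hr (genInv_le hr le_rfl))
    (isLeast_genInv hD hv.2).1.2

end GenInv

/-- `d` is a density on the unit interval, of arbitrary finite mass. -/
structure IsDensity (d : ℝ → ℝ) : Prop where
  measurable : Measurable d
  nonneg : ∀ u, 0 ≤ d u
  intervalIntegrable : IntervalIntegrable d volume 0 1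

/-- The measure on the unit interval with density `d`. -/
noncomputable def densityMeasure (d : ℝ → ℝ) : Measure ℝ :=
  lam.withDensity fun u => ENNReal.ofReal (d u)

/-- The distribution function of the density `d`. -/
noncomputable def distFun (d : ℝ → ℝ) (u : ℝ) : ℝ := ∫ v in (0 : ℝ)..u, d v

/-- The monotone transport map from the density `d` to the density `e`. -/
noncomputable def transport (d e : ℝ → ℝ) (u : ℝ) : ℝ := genInv (distFun e) (distFun d u)

lemma measurable_intervalIntegral {f : ℝ → ℝ} (hf : Measurable f) (a : ℝ) :
    Measurable fun u => ∫ v in a..u, f v := by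
  have hleft : MeasurableSet {z : ℝ × ℝ | z.2 ∈ Ioc a z.1} :=
    (measurableSet_lt measurable_const measurable_snd).inter
      (measurableSet_le measurable_snd measurable_fst)
  have hright : MeasurableSet {z : ℝ × ℝ | z.2 ∈ Ioc z.1 a} :=
    (measurableSet_lt measurable_fst measurable_snd).inter
      (measurableSet_le measurable_snd measurable_const)
  have hsnd : Measurable fun z : ℝ × ℝ => f z.2 := hf.comp measurable_snd
  convert ((hsnd.indicator hleft).stronglyMeasurable.integral_prod_right'
    (ν := volume)).measurable.sub
    ((hsnd.indicator hright).stronglyMeasurable.integral_prod_right' (ν := volume)).measurable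
    using 1
  funext u
  rw [intervalIntegral, ← integral_indicator measurableSet_Ioc,
    ← integral_indicator measurableSet_Ioc]
  rfl

section Transport

variable {d e : ℝ → ℝ} {P : ℝ → Prop} {u : ℝ}

lemma ae_densityMeasure_mem : ∀ᵐ u ∂densityMeasure d, u ∈ Icc (0 : ℝ) 1 :=
  (withDensity_absolutelyContinuous _ _).ae_le (ae_lam_mem.mono fun _ hu => Ioo_subset_Icc_self hu)

lemma ext_of_Iic_of_ae_mem_Icc {η η' : Measure ℝ} [IsFiniteMeasure η]
    (hη : ∀ᵐ x ∂η, x ∈ Icc (0 : ℝ) 1) (hη' : ∀ᵐ x ∂η', x ∈ Icc (0 : ℝ) 1)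
    (h : ∀ r ∈ Icc (0 : ℝ) 1, η (Iic r) = η' (Iic r)) : η = η' := by
  have hneg {ρ : Measure ℝ} (hρ : ∀ᵐ x ∂ρ, x ∈ Icc (0 : ℝ) 1) {r : ℝ} (hr : r < 0) :
      ρ (Iic r) = 0 :=
    measure_eq_zero_iff_ae_notMem.2 (hρ.mono fun x hx hxr => (hx.1.trans hxr).not_gt hr)
  have hmin {ρ : Measure ℝ} (hρ : ∀ᵐ x ∂ρ, x ∈ Icc (0 : ℝ) 1) (r : ℝ) :
      ρ (Iic r) = ρ (Iic (min r 1)) :=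
    measure_congr (hρ.mono fun x hx => propext (le_min_iff.trans (and_iff_left hx.2)).symm)
  refine Measure.ext_of_Iic _ _ fun r => ?_
  rcases lt_or_ge r 0 with hr | hr
  · rw [hneg hη hr, hneg hη' hr]
  · rw [hmin hη, hmin hη', h _ ⟨le_min hr zero_le_one, min_le_right r 1⟩]

namespace IsDensity

lemma continuousOn_distFun (hd : IsDensity d) : ContinuousOn (distFun d) (Icc 0 1) :=
  continuousOn_primitive zero_le_one hd.intervalIntegrable

lemma monotoneOn_distFun (hd : IsDensity d) : MonotoneOn (distFun d) (Icc 0 1) := by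
  intro a ha b hb hab
  have hnonneg := intervalIntegral.integral_nonneg (μ := volume) hab fun u _ => hd.nonneg u
  rw [distFun, distFun, ← intervalIntegral.integral_add_adjacent_intervals
    (intervalIntegrable_of_le hd.intervalIntegrable le_rfl ha.1 ha.2)
    (intervalIntegrable_of_le hd.intervalIntegrable ha.1 hab hb.2)]
  exact le_add_of_nonneg_right hnonneg

lemma distFun_mem_Icc (hd : IsDensity d) (hu : u ∈ Icc (0 : ℝ) 1) :
    distFun d u ∈ Icc (distFun d 0) (distFun d 1) :=
  ⟨hd.monotoneOn_distFun (left_mem_Icc.2 zero_le_one) hu hu.1,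
    hd.monotoneOn_distFun hu (right_mem_Icc.2 zero_le_one) hu.2⟩

lemma densityMeasure_Iic (hd : IsDensity d) (hu : u ∈ Icc (0 : ℝ) 1) :
    densityMeasure d (Iic u) = ENNReal.ofReal (distFun d u) := by
  rw [densityMeasure, withDensity_apply _ measurableSet_Iic, lam_restrict_Iic hu.2, distFun,
    intervalIntegral.integral_of_le hu.1, ofReal_integral_eq_lintegral_ofReal
      ((intervalIntegrable_iff_integrableOn_Ioc_of_le hu.1).1
        (intervalIntegrable_of_le hd.intervalIntegrable le_rfl hu.1 hu.2)) (.of_forall hd.nonneg)]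

lemma isFiniteMeasure_densityMeasure (hd : IsDensity d) : IsFiniteMeasure (densityMeasure d) := by
  refine ⟨?_⟩
  have hsupp : densityMeasure d univ = densityMeasure d (Iic 1) :=
    measure_congr (ae_densityMeasure_mem.mono fun u hu => propext (iff_of_true trivial hu.2))
  rw [hsupp, hd.densityMeasure_Iic (right_mem_Icc.2 zero_le_one)]
  exact ENNReal.ofReal_lt_top

lemma densityMeasure_setOf_distFun_le (hd : IsDensity d) {t : ℝ}
    (ht : t ∈ Icc (distFun d 0) (distFun d 1)) :
    densityMeasure d {u | distFun d u ≤ t} = ENNReal.ofReal t := by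
  have hcompact : IsCompact (Icc (0 : ℝ) 1 ∩ distFun d ⁻¹' Iic t) :=
    isCompact_Icc.of_isClosed_subset (hd.continuousOn_distFun.preimage_isClosed_of_isClosed
      isClosed_Icc isClosed_Iic) inter_subset_left
  obtain ⟨r, ⟨hr, hrt⟩, hgreatest⟩ :=
    hcompact.exists_isGreatest ⟨0, left_mem_Icc.2 zero_le_one, ht.1⟩
  have hdist : distFun d r = t := by
    obtain ⟨s, hs, rfl⟩ := intermediate_value_Icc zero_le_one hd.continuousOn_distFun ht
    exact le_antisymm hrt (hd.monotoneOn_distFun hs hr (hgreatest ⟨hs, le_refl (distFun d s)⟩))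
  rw [← hdist, ← hd.densityMeasure_Iic hr]
  exact measure_congr (ae_densityMeasure_mem.mono fun u hu => propext
    ⟨fun h => hgreatest ⟨hu, hdist ▸ h⟩, fun h => hd.monotoneOn_distFun hu hr h⟩)

lemma ae_iff (hd : IsDensity d) :
    (∀ᵐ u ∂densityMeasure d, P u) ↔ ∀ᵐ u ∂lam, 0 < d u → P u := by
  rw [densityMeasure, ae_withDensity_iff hd.measurable.ennreal_ofReal]
  simp only [ne_eq, ENNReal.ofReal_eq_zero, not_le]

lemma measurable_transport (hd : IsDensity d) (he : IsDensity e) : Measurable (transport d e) :=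
  (measurable_genInv he.monotoneOn_distFun).comp (measurable_intervalIntegral hd.measurable 0)

lemma distFun_transport (hd : IsDensity d) (he : IsDensity e)
    (hmass : distFun d 1 = distFun e 1) (hu : u ∈ Icc (0 : ℝ) 1) :
    distFun e (transport d e u) = distFun d u := by
  have hzero : distFun d 0 = distFun e 0 :=
    intervalIntegral.integral_same.trans intervalIntegral.integral_same.symm
  exact apply_genInv he.continuousOn_distFun he.monotoneOn_distFun
    (hzero ▸ hmass ▸ hd.distFun_mem_Icc hu)

lemma map_transport (hd : IsDensity d) (he : IsDensity e) (hmass : distFun d 1 = distFun e 1) :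
    (densityMeasure d).map (transport d e) = densityMeasure e := by
  have := hd.isFiniteMeasure_densityMeasure
  have := he.isFiniteMeasure_densityMeasure
  have hT := hd.measurable_transport he
  refine ext_of_Iic_of_ae_mem_Icc ((ae_map_iff hT.aemeasurable measurableSet_Icc).2
    (.of_forall fun u => genInv_mem_Icc _ _)) ae_densityMeasure_mem fun r hr => ?_
  have hzero : distFun e 0 = distFun d 0 :=
    intervalIntegral.integral_same.trans intervalIntegral.integral_same.symm
  rw [Measure.map_apply hT measurableSet_Iic, he.densityMeasure_Iic hr,
    ← hd.densityMeasure_setOf_distFun_le (hzero ▸ hmass ▸ he.distFun_mem_Icc hr)]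
  exact measure_congr (ae_densityMeasure_mem.mono fun u hu => propext
    (genInv_le_iff he.continuousOn_distFun he.monotoneOn_distFun
      (hmass ▸ (hd.distFun_mem_Icc hu).2) hr))

-- The transport of `d` to itself is below the identity and has the same integral.
lemma transport_self_ae (hd : IsDensity d) : ∀ᵐ u ∂densityMeasure d, transport d d u = u := by
  have := hd.isFiniteMeasure_densityMeasure
  have hT := hd.measurable_transport hd
  have hle : ∀ᵐ u ∂densityMeasure d, transport d d u ≤ u :=
    ae_densityMeasure_mem.mono fun u hu => genInv_le hu le_rfl
  have hid : Integrable (fun u : ℝ => u) (densityMeasure d) :=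
    .of_mem_Icc 0 1 aemeasurable_id ae_densityMeasure_mem
  have hself : Integrable (transport d d) (densityMeasure d) :=
    .of_mem_Icc 0 1 hT.aemeasurable (.of_forall fun u => genInv_mem_Icc _ _)
  refine (integral_eq_iff_of_ae_le hself hid hle).1 ?_
  rw [← integral_id_map hT.aemeasurable, hd.map_transport hd rfl]

lemma transport_transport_ae (hd : IsDensity d) (he : IsDensity e)
    (hmass : distFun d 1 = distFun e 1) :
    ∀ᵐ u ∂lam, 0 < d u → transport e d (transport d e u) = u := by
  refine hd.ae_iff.1 ?_
  filter_upwards [hd.transport_self_ae, ae_densityMeasure_mem] with u hself hu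
  rw [transport, hd.distFun_transport he hmass hu]
  exact hself

lemma ae_transport (hd : IsDensity d) (he : IsDensity e) (hmass : distFun d 1 = distFun e 1)
    (hP : ∀ᵐ v ∂lam, 0 < e v → P v) : ∀ᵐ u ∂lam, 0 < d u → P (transport d e u) := by
  rw [← he.ae_iff, ← hd.map_transport he hmass] at hP
  exact hd.ae_iff.1 (ae_of_ae_map (hd.measurable_transport he).aemeasurable hP)

lemma lintegral_transport (hd : IsDensity d) (he : IsDensity e)
    (hmass : distFun d 1 = distFun e 1) {f : ℝ → ENNReal} (hf : Measurable f) :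
    ∫⁻ v, ENNReal.ofReal (e v) * f v ∂lam =
      ∫⁻ u, ENNReal.ofReal (d u) * f (transport d e u) ∂lam := by
  have hT := hd.measurable_transport he
  have hdensity {c g} (hc : IsDensity c) (hg : Measurable g) :
      ∫⁻ u, ENNReal.ofReal (c u) * g u ∂lam = ∫⁻ u, g u ∂densityMeasure c :=
    (lintegral_withDensity_eq_lintegral_mul lam hc.measurable.ennreal_ofReal hg).symm
  rw [hdensity he hf, hdensity (g := fun u => f (transport d e u)) hd (hf.comp hT),
    ← hd.map_transport he hmass, lintegral_map hf hT]

end IsDensity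

end Transport

/-! ### Barycentre dispersion along the quantile function -/

section Levels

variable {η : Measure ℝ} {g : ℝ → ℝ}

lemma setIntegral_le_setIntegral_of_sign {X : Type*} [MeasurableSpace X] {ρ : Measure X}
    {f : X → ℝ} {s t : Set X} (hs : MeasurableSet s) (ht : MeasurableSet t) (hf : Integrable f ρ)
    (hst : ∀ᵐ x ∂ρ, x ∈ s → x ∉ t → f x ≤ 0) (hts : ∀ᵐ x ∂ρ, x ∈ t → x ∉ s → 0 ≤ f x) :
    ∫ x in s, f x ∂ρ ≤ ∫ x in t, f x ∂ρ := by
  rw [← integral_indicator hs, ← integral_indicator ht]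
  refine integral_mono_ae (hf.indicator hs) (hf.indicator ht) ?_
  filter_upwards [hst, hts] with x hst hts
  by_cases hxs : x ∈ s <;> by_cases hxt : x ∈ t <;> simp [hxs, hxt, hst, hts]

lemma setIntegral_Ioi_nonpos (hg : Integrable g η) (hIci : ∀ a, ∫ x in Ici a, g x ∂η ≤ 0) (a : ℝ) :
    ∫ x in Ioi a, g x ∂η ≤ 0 := by
  obtain ⟨b, hanti, hab, hlim⟩ := exists_seq_strictAnti_tendsto a
  have hmono : Monotone fun n => Ici (b n) := fun m n hmn => Ici_subset_Ici.2 (hanti.antitone hmn)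
  rw [← iUnion_Ici_eq_Ioi_of_lt_of_tendsto hab hlim]
  exact le_of_tendsto (tendsto_setIntegral_of_monotone (fun n => measurableSet_Ici) hmono
    hg.integrableOn) (.of_forall fun n => hIci (b n))

variable [IsProbabilityMeasure η]

lemma integrable_comp_quantile (hg : Integrable g η) : Integrable (fun u => g (quantile η u)) lam :=
  (measurePreserving_quantile η).integrable_comp_of_integrable hg

lemma setIntegral_comp_quantile (hg : Integrable g η) {s : Set ℝ} (hs : MeasurableSet s) :
    ∫ u in quantile η ⁻¹' s, g (quantile η u) ∂lam = ∫ x in s, g x ∂η := by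
  conv_rhs => rw [← map_quantile η]
  exact (setIntegral_map hs ((map_quantile η).symm ▸ hg.aestronglyMeasurable)
    (measurable_quantile η).aemeasurable).symm

-- `Ioi u` lies between the preimages of `Ioi a` and `Ici a`, `a` being the quantile at `u`, and the
-- integrand equals `g a` on the part of `Ici a` that is not in `Ioi a`; the sign of `g a` decides
-- which of the two preimages has the larger integral.
lemma setIntegral_Ioi_comp_quantile_nonpos (hg : Integrable g η)
    (hIci : ∀ a, ∫ x in Ici a, g x ∂η ≤ 0) {u : ℝ} (hu : u ∈ Ioo (0 : ℝ) 1) :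
    ∫ v in Ioi u, g (quantile η v) ∂lam ≤ 0 := by
  set a := quantile η u
  have hquantile := measurable_quantile η
  have hle : ∀ᵐ v ∂lam, v ≤ u → quantile η v ≤ a :=
    ae_lam_mem.mono fun v hv hvu => monotoneOn_quantile η hv hu hvu
  have hge : ∀ᵐ v ∂lam, u < v → a ≤ quantile η v :=
    ae_lam_mem.mono fun v hv huv => monotoneOn_quantile η hu hv huv.le
  rcases le_total (g a) 0 with hga | hga
  · refine (setIntegral_le_setIntegral_of_sign measurableSet_Ioi (hquantile measurableSet_Ioi)
      (integrable_comp_quantile hg) (hge.mono fun v hge huv hv => ?_)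
      (hle.mono fun v hle hv huv => absurd (hle (not_lt.1 huv)) (not_le.2 hv))).trans
      ((setIntegral_comp_quantile hg measurableSet_Ioi).trans_le (setIntegral_Ioi_nonpos hg hIci a))
    rwa [le_antisymm (not_lt.1 hv) (hge huv)]
  · refine (setIntegral_le_setIntegral_of_sign measurableSet_Ioi (hquantile measurableSet_Ici)
      (integrable_comp_quantile hg) (hge.mono fun v hge huv hv => absurd (hge huv) hv)
      (hle.mono fun v hle hv huv => ?_)).trans
      ((setIntegral_comp_quantile hg measurableSet_Ici).trans_le (hIci a))
    rwa [le_antisymm (hle (not_lt.1 huv)) hv]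

end Levels

/-- The positive part of the defect `F_μ⁻¹ - G`, with primitive `Δ₊`. -/
noncomputable def defectPos (μ : Measure ℝ) (κ : Kernel ℝ ℝ) (u : ℝ) : ℝ :=
  max (quantile μ u - G μ κ u) 0

/-- The negative part of the defect `F_μ⁻¹ - G`, with primitive `Δ₋`. -/
noncomputable def defectNeg (μ : Measure ℝ) (κ : Kernel ℝ ℝ) (u : ℝ) : ℝ :=
  max (-(quantile μ u - G μ κ u)) 0

/-- The standing assumptions on `π(dx, dy) = μ(dx) κ_x(dy)`: both marginals have a first moment and
the same mean, and barycentre dispersion holds. -/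
structure IsDispersed (μ : Measure ℝ) (κ : Kernel ℝ ℝ) : Prop where
  integrable_fst : Integrable (fun x => x) μ
  integrable_snd : Integrable (fun z : ℝ × ℝ => z.2) (μ ⊗ₘ κ)
  mean_eq : ∫ x, x ∂μ = ∫ z, z.2 ∂(μ ⊗ₘ κ)
  dispersion : BarycentreDispersion μ κ

section Barycentre

variable {μ : Measure ℝ} {κ : Kernel ℝ ℝ} {u : ℝ}

lemma DeltaPos_eq_distFun : DeltaPos μ κ = distFun (defectPos μ κ) := rfl

lemma DeltaNeg_eq_distFun : DeltaNeg μ κ = distFun (defectNeg μ κ) := rfl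

lemma measurable_G [IsProbabilityMeasure μ] : Measurable (G μ κ) :=
  (measurable_barycentre κ).comp (measurable_quantile μ)

namespace IsDispersed

variable [IsProbabilityMeasure μ] [IsMarkovKernel κ] (h : IsDispersed μ κ)
include h

lemma ae_integrable : ∀ᵐ x ∂μ, Integrable (fun y : ℝ => y) (κ x) :=
  ((Measure.integrable_compProd_iff h.integrable_snd.1).1 h.integrable_snd).1

lemma ae_integrable_quantile : ∀ᵐ u ∂lam, Integrable (fun y : ℝ => y) (κ (quantile μ u)) :=
  (measurePreserving_quantile μ).quasiMeasurePreserving.ae h.ae_integrable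

lemma integrable_barycentre : Integrable (fun x => ∫ y, y ∂(κ x)) μ :=
  ((Measure.integrable_compProd_iff h.integrable_snd.1).1 h.integrable_snd).2.mono'
    (measurable_barycentre κ).aestronglyMeasurable
    (.of_forall fun _ => norm_integral_le_integral_norm _)

lemma integrable_defect : Integrable (fun x => x - ∫ y, y ∂(κ x)) μ :=
  h.integrable_fst.sub h.integrable_barycentre

lemma integrable_defect_quantile : Integrable (fun u => quantile μ u - G μ κ u) lam :=
  integrable_comp_quantile h.integrable_defect

lemma integrable_abs_G_sub_quantile : Integrable (fun u => |G μ κ u - quantile μ u|) lam :=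
  h.integrable_defect_quantile.abs.congr (.of_forall fun _ => abs_sub_comm _ _)

lemma integral_defect_quantile : ∫ u, (quantile μ u - G μ κ u) ∂lam = 0 := by
  have hcomp := setIntegral_comp_quantile h.integrable_defect MeasurableSet.univ
  rw [preimage_univ, setIntegral_univ, setIntegral_univ] at hcomp
  exact hcomp.trans (by rw [integral_sub h.integrable_fst h.integrable_barycentre, h.mean_eq,
    Measure.integral_compProd h.integrable_snd, sub_self])

lemma isDensity_defectPos : IsDensity (defectPos μ κ) where
  measurable := ((measurable_quantile μ).sub measurable_G).max measurable_const
  nonneg _ := le_max_right _ _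
  intervalIntegrable := (intervalIntegrable_iff_integrableOn_Ioo_of_le zero_le_one).2
    h.integrable_defect_quantile.pos_part

lemma isDensity_defectNeg : IsDensity (defectNeg μ κ) where
  measurable := ((measurable_quantile μ).sub measurable_G).neg.max measurable_const
  nonneg _ := le_max_right _ _
  intervalIntegrable := (intervalIntegrable_iff_integrableOn_Ioo_of_le zero_le_one).2
    h.integrable_defect_quantile.neg_part

lemma DeltaPos_sub_DeltaNeg (hu : u ∈ Icc (0 : ℝ) 1) :
    DeltaPos μ κ u - DeltaNeg μ κ u = -∫ v in Ioi u, (quantile μ v - G μ κ v) ∂lam := by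
  have hsplit := integral_add_compl (measurableSet_Iic (a := u)) h.integrable_defect_quantile
  rw [h.integral_defect_quantile, compl_Iic] at hsplit
  rw [← eq_neg_of_add_eq_zero_left hsplit, lam_restrict_Iic hu.2,
    ← intervalIntegral.integral_of_le hu.1, DeltaPos_eq_distFun, DeltaNeg_eq_distFun, distFun,
    distFun, ← intervalIntegral.integral_sub
      (intervalIntegrable_of_le h.isDensity_defectPos.intervalIntegrable le_rfl hu.1 hu.2)
      (intervalIntegrable_of_le h.isDensity_defectNeg.intervalIntegrable le_rfl hu.1 hu.2)]
  exact intervalIntegral.integral_congr fun v _ => max_zero_sub_max_neg_zero_eq_self _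

lemma DeltaNeg_le_DeltaPos (hu : u ∈ Ioo (0 : ℝ) 1) : DeltaNeg μ κ u ≤ DeltaPos μ κ u := by
  rw [← sub_nonneg, h.DeltaPos_sub_DeltaNeg (Ioo_subset_Icc_self hu), neg_nonneg]
  exact setIntegral_Ioi_comp_quantile_nonpos h.integrable_defect h.dispersion hu

lemma DeltaPos_one : DeltaPos μ κ 1 = DeltaNeg μ κ 1 := by
  have hnull : lam (Ioi 1) = 0 :=
    measure_eq_zero_iff_ae_notMem.2 (ae_lam_mem.mono fun u hu => hu.2.not_gt)
  rw [← sub_eq_zero, h.DeltaPos_sub_DeltaNeg (right_mem_Icc.2 zero_le_one),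
    Measure.restrict_eq_zero.2 hnull, integral_zero_measure, neg_zero]

end IsDispersed

end Barycentre

/-! ### The pairing of levels -/

section Pairing

variable {μ : Measure ℝ} {κ : Kernel ℝ ℝ} {u : ℝ}

lemma notMem_UNeg_of_mem_UPos (hu : u ∈ UPos μ κ) : u ∉ UNeg μ κ := fun h => lt_asymm hu.2.2 h.2.2

lemma notMem_APos_of_mem_ANeg (hu : u ∈ ANeg μ κ) : u ∉ APos μ κ :=
  fun h => notMem_UNeg_of_mem_UPos h.1 hu.1

lemma phi_of_mem_UPos (hu : u ∈ UPos μ κ) :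
    phi μ κ u = transport (defectPos μ κ) (defectNeg μ κ) u := by
  rw [phi, if_pos hu]
  rfl

lemma phi_of_mem_UNeg (hu : u ∈ UNeg μ κ) :
    phi μ κ u = transport (defectNeg μ κ) (defectPos μ κ) u := by
  rw [phi, if_neg fun h => notMem_UNeg_of_mem_UPos h hu, if_pos hu]
  rfl

lemma defectPos_of_mem_UPos (hu : u ∈ UPos μ κ) : defectPos μ κ u = quantile μ u - G μ κ u :=
  max_eq_left (sub_nonneg.2 hu.2.2.le)

lemma defectNeg_of_mem_UNeg (hu : u ∈ UNeg μ κ) : defectNeg μ κ u = G μ κ u - quantile μ u := by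
  rw [defectNeg, neg_sub, max_eq_left (sub_nonneg.2 hu.2.2.le)]

lemma pw_phi (hinv : phi μ κ (phi μ κ u) = u)
    (hne : quantile μ u - G μ κ u + G μ κ (phi μ κ u) - quantile μ (phi μ κ u) ≠ 0) :
    pw μ κ (phi μ κ u) = 1 - pw μ κ u := by
  have hne' : quantile μ (phi μ κ u) - G μ κ (phi μ κ u) + G μ κ u - quantile μ u ≠ 0 :=
    fun h => hne (by linarith)
  rw [pw, pw, hinv, eq_sub_iff_add_eq, div_add_div _ _ hne' hne,
    div_eq_one_iff_eq (mul_ne_zero hne' hne)]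
  ring

lemma mem_APos_of_phi_phi (hu : u ∈ UPos μ κ) (hphi : phi μ κ u ∈ UNeg μ κ)
    (hinv : phi μ κ (phi μ κ u) = u) : u ∈ APos μ κ :=
  ⟨hu, hphi, hinv, pw_phi hinv (by linarith [hu.2.2, hphi.2.2] : (0 : ℝ) < _).ne'⟩

lemma mem_ANeg_of_phi_phi (hu : u ∈ UNeg μ κ) (hphi : phi μ κ u ∈ UPos μ κ)
    (hinv : phi μ κ (phi μ κ u) = u) : u ∈ ANeg μ κ :=
  ⟨hu, hphi, hinv, pw_phi hinv (by linarith [hu.2.2, hphi.2.2] : _ < (0 : ℝ)).ne⟩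

lemma phi_mem_ANeg (hu : u ∈ APos μ κ) : phi μ κ u ∈ ANeg μ κ :=
  mem_ANeg_of_phi_phi hu.2.1 (hu.2.2.1.symm ▸ hu.1) (congrArg _ hu.2.2.1)

lemma phi_mem_APos (hu : u ∈ ANeg μ κ) : phi μ κ u ∈ APos μ κ :=
  mem_APos_of_phi_phi hu.2.1 (hu.2.2.1.symm ▸ hu.1) (congrArg _ hu.2.2.1)

lemma pw_mem_Ioo (hu : u ∈ APos μ κ) : pw μ κ u ∈ Ioo (0 : ℝ) 1 := by
  have hpos := hu.1.2.2
  have hneg := hu.2.1.2.2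
  rw [pw, mem_Ioo, div_lt_one (by linarith)]
  exact ⟨div_pos (by linarith) (by linarith), by linarith⟩

lemma ofReal_one_sub_pw_div_pw (hu : u ∈ APos μ κ) :
    ENNReal.ofReal (1 - pw μ κ u) / ENNReal.ofReal (pw μ κ u) =
      ENNReal.ofReal (defectPos μ κ u) / ENNReal.ofReal (defectNeg μ κ (phi μ κ u)) := by
  have hpos := hu.1.2.2
  have hneg := hu.2.1.2.2
  have hneg' : 0 < G μ κ (phi μ κ u) - quantile μ (phi μ κ u) := sub_pos.2 hneg
  have hsum : quantile μ u - G μ κ u + G μ κ (phi μ κ u) - quantile μ (phi μ κ u) ≠ 0 :=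
    (by linarith : (0 : ℝ) < _).ne'
  rw [defectPos_of_mem_UPos hu.1, defectNeg_of_mem_UNeg hu.2.1,
    ← ENNReal.ofReal_div_of_pos (pw_mem_Ioo hu).1, ← ENNReal.ofReal_div_of_pos hneg', pw]
  congr 1
  field_simp
  ring

section Measurability

variable [IsProbabilityMeasure μ]

lemma measurableSet_integrable_quantile :
    MeasurableSet {u | Integrable (fun y : ℝ => y) (κ (quantile μ u))} :=
  measurable_quantile μ (ProbabilityTheory.measurableSet_integrable stronglyMeasurable_id)

lemma measurableSet_UPos : MeasurableSet (UPos μ κ) :=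
  measurableSet_Ioo.inter (measurableSet_integrable_quantile.inter
    (measurableSet_lt measurable_G (measurable_quantile μ)))

lemma measurableSet_UNeg : MeasurableSet (UNeg μ κ) :=
  measurableSet_Ioo.inter (measurableSet_integrable_quantile.inter
    (measurableSet_lt (measurable_quantile μ) measurable_G))

end Measurability

namespace IsDispersed

variable [IsProbabilityMeasure μ] [IsMarkovKernel κ] (h : IsDispersed μ κ)
include h

lemma measurable_phi : Measurable (phi μ κ) := by
  have htransport := h.isDensity_defectPos.measurable_transport h.isDensity_defectNeg
  have htransport' := h.isDensity_defectNeg.measurable_transport h.isDensity_defectPos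
  classical
  unfold phi
  exact htransport.ite measurableSet_UPos (htransport'.ite measurableSet_UNeg measurable_id)

lemma measurable_pw : Measurable (pw μ κ) := by
  have hG : Measurable (G μ κ) := measurable_G
  have hquantile := measurable_quantile μ
  have hphi := h.measurable_phi
  unfold pw
  fun_prop

lemma measurableSet_APos : MeasurableSet (APos μ κ) :=
  measurableSet_UPos.inter ((h.measurable_phi measurableSet_UNeg).inter
    ((measurableSet_eq_fun (h.measurable_phi.comp h.measurable_phi) measurable_id).inter
      (measurableSet_eq_fun (h.measurable_pw.comp h.measurable_phi)
        (measurable_const.sub h.measurable_pw))))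

lemma measurableSet_ANeg : MeasurableSet (ANeg μ κ) :=
  measurableSet_UNeg.inter ((h.measurable_phi measurableSet_UPos).inter
    ((measurableSet_eq_fun (h.measurable_phi.comp h.measurable_phi) measurable_id).inter
      (measurableSet_eq_fun (h.measurable_pw.comp h.measurable_phi)
        (measurable_const.sub h.measurable_pw))))

lemma ae_mem_UPos_iff : ∀ᵐ u ∂lam, u ∈ UPos μ κ ↔ 0 < defectPos μ κ u := by
  filter_upwards [ae_lam_mem, h.ae_integrable_quantile] with u hu hint
  rw [defectPos, lt_max_iff, sub_pos, or_iff_left (lt_irrefl _)]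
  exact ⟨fun hmem => hmem.2.2, fun hlt => ⟨hu, hint, hlt⟩⟩

lemma ae_mem_UNeg_iff : ∀ᵐ u ∂lam, u ∈ UNeg μ κ ↔ 0 < defectNeg μ κ u := by
  filter_upwards [ae_lam_mem, h.ae_integrable_quantile] with u hu hint
  rw [defectNeg, neg_sub, lt_max_iff, sub_pos, or_iff_left (lt_irrefl _)]
  exact ⟨fun hmem => hmem.2.2, fun hlt => ⟨hu, hint, hlt⟩⟩

lemma ae_mem_APos_of_mem_UPos : ∀ᵐ u ∂lam, u ∈ UPos μ κ → u ∈ APos μ κ := by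
  have hmem := h.isDensity_defectPos.ae_transport h.isDensity_defectNeg h.DeltaPos_one
    (h.ae_mem_UNeg_iff.mono fun _ => Iff.mpr)
  filter_upwards [h.ae_mem_UPos_iff, hmem, h.isDensity_defectPos.transport_transport_ae
    h.isDensity_defectNeg h.DeltaPos_one] with u hiff hmem hinv hu
  have hpos := hiff.1 hu
  rw [← phi_of_mem_UPos hu] at hmem hinv
  exact mem_APos_of_phi_phi hu (hmem hpos) ((phi_of_mem_UNeg (hmem hpos)).trans (hinv hpos))

lemma ae_mem_ANeg_of_mem_UNeg : ∀ᵐ u ∂lam, u ∈ UNeg μ κ → u ∈ ANeg μ κ := by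
  have hmem := h.isDensity_defectNeg.ae_transport h.isDensity_defectPos h.DeltaPos_one.symm
    (h.ae_mem_UPos_iff.mono fun _ => Iff.mpr)
  filter_upwards [h.ae_mem_UNeg_iff, hmem, h.isDensity_defectNeg.transport_transport_ae
    h.isDensity_defectPos h.DeltaPos_one.symm] with u hiff hmem hinv hu
  have hneg := hiff.1 hu
  rw [← phi_of_mem_UNeg hu] at hmem hinv
  exact mem_ANeg_of_phi_phi hu (hmem hneg) ((phi_of_mem_UPos (hmem hneg)).trans (hinv hneg))

lemma ae_G_eq_quantile :
    ∀ᵐ u ∂lam, u ∉ APos μ κ → u ∉ ANeg μ κ → G μ κ u = quantile μ u := by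
  filter_upwards [h.ae_mem_APos_of_mem_UPos, h.ae_mem_ANeg_of_mem_UNeg, ae_lam_mem,
    h.ae_integrable_quantile] with u hpos hneg hu hint hnpos hnneg
  rcases lt_trichotomy (G μ κ u) (quantile μ u) with hlt | heq | hgt
  · exact absurd (hpos ⟨hu, hint, hlt⟩) hnpos
  · exact heq
  · exact absurd (hneg ⟨hu, hint, hgt⟩) hnneg

-- As `Δ₋ ≤ Δ₊`, the mass `Δ₋(φ u)` is already reached by `Δ₊` at the level `φ u`.
lemma le_phi (hu : u ∈ APos μ κ) : u ≤ phi μ κ u := by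
  have hle : genInv (DeltaPos μ κ) (DeltaNeg μ κ (phi μ κ u)) ≤ phi μ κ u :=
    genInv_le (Ioo_subset_Icc_self hu.2.1.1) (h.DeltaNeg_le_DeltaPos hu.2.1.1)
  exact (hu.2.2.1.symm.trans (phi_of_mem_UNeg hu.2.1)).trans_le hle

lemma quad_mem_quadruples (hu : u ∈ APos μ κ) : quad μ κ u ∈ quadruples :=
  ⟨⟨IsMarkovKernel.isProbabilityMeasure _, hu.1.2.1⟩,
    ⟨IsMarkovKernel.isProbabilityMeasure _, hu.2.1.2.1⟩, hu.1.2.2,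
    monotoneOn_quantile μ hu.1.1 hu.2.1.1 (h.le_phi hu), hu.2.1.2.2⟩

lemma setLIntegral_ANeg {f : ℝ → ENNReal} (hf : Measurable f) :
    ∫⁻ v in ANeg μ κ, f v ∂lam = ∫⁻ u in APos μ κ,
      ENNReal.ofReal (1 - pw μ κ u) / ENNReal.ofReal (pw μ κ u) * f (phi μ κ u) ∂lam := by
  set k : ℝ → ENNReal := (ANeg μ κ).indicator fun v => f v / ENNReal.ofReal (defectNeg μ κ v)
    with hk
  have hk_measurable : Measurable k :=
    (hf.div h.isDensity_defectNeg.measurable.ennreal_ofReal).indicator h.measurableSet_ANeg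
  rw [← lintegral_indicator h.measurableSet_ANeg, ← lintegral_indicator h.measurableSet_APos]
  calc ∫⁻ v, (ANeg μ κ).indicator f v ∂lam
      = ∫⁻ v, ENNReal.ofReal (defectNeg μ κ v) * k v ∂lam := lintegral_congr fun v => by
        by_cases hv : v ∈ ANeg μ κ
        · have hpos : 0 < defectNeg μ κ v :=
            (sub_pos.2 hv.1.2.2).trans_eq (defectNeg_of_mem_UNeg hv.1).symm
          rw [hk, indicator_of_mem hv, indicator_of_mem hv,
            ENNReal.mul_div_cancel (ENNReal.ofReal_pos.2 hpos).ne' ENNReal.ofReal_ne_top]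
        · rw [hk, indicator_of_notMem hv, indicator_of_notMem hv, mul_zero]
    _ = ∫⁻ u, ENNReal.ofReal (defectPos μ κ u) *
          k (transport (defectPos μ κ) (defectNeg μ κ) u) ∂lam :=
        h.isDensity_defectPos.lintegral_transport h.isDensity_defectNeg h.DeltaPos_one hk_measurable
    _ = ∫⁻ u, (APos μ κ).indicator (fun u => ENNReal.ofReal (1 - pw μ κ u) /
          ENNReal.ofReal (pw μ κ u) * f (phi μ κ u)) u ∂lam := lintegral_congr_ae ?_
  filter_upwards [h.ae_mem_UPos_iff, h.ae_mem_APos_of_mem_UPos] with u hiff hmem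
  by_cases hu : u ∈ APos μ κ
  · rw [indicator_of_mem hu, ← phi_of_mem_UPos hu.1, hk, indicator_of_mem (phi_mem_ANeg hu),
      ofReal_one_sub_pw_div_pw hu, ENNReal.mul_comm_div]
  · have hzero : ENNReal.ofReal (defectPos μ κ u) = 0 :=
      ENNReal.ofReal_eq_zero.2 (not_lt.1 fun hpos => hu (hmem (hiff.2 hpos)))
    rw [indicator_of_notMem hu, hzero, zero_mul]

end IsDispersed

end Pairing

/-! ### The martingale kernel -/

section Mker

variable {μ ν : Measure ℝ} {κ : Kernel ℝ ℝ} {β β' : ℝ × ℝ × Measure ℝ × Measure ℝ → Measure ℝ}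
  {u : ℝ}

lemma mker_of_mem_APos (hu : u ∈ APos μ κ) : mker β β' μ κ u = β (quad μ κ u) := if_pos hu

lemma mker_of_mem_ANeg (hu : u ∈ ANeg μ κ) : mker β β' μ κ u = β' (quad μ κ (phi μ κ u)) := by
  rw [mker, if_neg (notMem_APos_of_mem_ANeg hu), if_pos hu]

lemma mker_of_notMem (hpos : u ∉ APos μ κ) (hneg : u ∉ ANeg μ κ) :
    mker β β' μ κ u = κ (quantile μ u) := by
  rw [mker, if_neg hpos, if_neg hneg]

namespace IsDispersed

variable [IsProbabilityMeasure μ] [IsMarkovKernel κ] (h : IsDispersed μ κ)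
include h

lemma measurable_quad : Measurable (quad μ κ) := by
  have hquantile := measurable_quantile μ
  have hphi := h.measurable_phi
  have hκ := κ.measurable
  unfold quad
  fun_prop

variable (hβ : IsExchange β β')
include hβ

lemma measurable_mker : Measurable (mker β β' μ κ) := by
  have hpos : Measurable fun u : APos μ κ => β (quad μ κ u) :=
    hβ.measurable_fst.comp ((h.measurable_quad.comp measurable_subtype_coe).subtype_mk
      (h := fun u => h.quad_mem_quadruples u.2))
  have hneg : Measurable fun u : ANeg μ κ => β' (quad μ κ (phi μ κ u)) :=
    hβ.measurable_snd.comp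
      (((h.measurable_quad.comp h.measurable_phi).comp measurable_subtype_coe).subtype_mk
        (h := fun u => h.quad_mem_quadruples (phi_mem_APos u.2)))
  have hrest : Measurable fun u => κ (quantile μ u) := κ.measurable.comp (measurable_quantile μ)
  classical
  exact hpos.dite ((hneg.dite (hrest.comp measurable_subtype_coe)
    h.measurableSet_ANeg).comp measurable_subtype_coe) h.measurableSet_APos

lemma isProbabilityMeasure_mker (u : ℝ) : IsProbabilityMeasure (mker β β' μ κ u) := by
  by_cases hpos : u ∈ APos μ κ
  · rw [mker_of_mem_APos hpos]
    exact (hβ.isP1_fst _ (h.quad_mem_quadruples hpos)).1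
  by_cases hneg : u ∈ ANeg μ κ
  · rw [mker_of_mem_ANeg hneg]
    exact (hβ.isP1_snd _ (h.quad_mem_quadruples (phi_mem_APos hneg))).1
  · rw [mker_of_notMem hpos hneg]
    infer_instance

lemma ae_integrable_mker_and_mean_eq : ∀ᵐ u ∂lam,
    Integrable (fun y : ℝ => y) (mker β β' μ κ u) ∧ ∫ y, y ∂(mker β β' μ κ u) = quantile μ u := by
  filter_upwards [h.ae_G_eq_quantile, h.ae_integrable_quantile] with u hG hint
  by_cases hpos : u ∈ APos μ κ
  · have hquad := h.quad_mem_quadruples hpos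
    rw [mker_of_mem_APos hpos]
    exact ⟨(hβ.isP1_fst _ hquad).2, hβ.mean_fst _ hquad⟩
  by_cases hneg : u ∈ ANeg μ κ
  · have hquad := h.quad_mem_quadruples (phi_mem_APos hneg)
    rw [mker_of_mem_ANeg hneg]
    exact ⟨(hβ.isP1_snd _ hquad).2,
      (hβ.mean_snd _ hquad).trans (congrArg (quantile μ) hneg.2.2.1)⟩
  · rw [mker_of_notMem hpos hneg]
    exact ⟨hint, hG hpos hneg⟩

lemma stochLE_mker (hu : u ∈ APos μ κ) : StochLE (κ (quantile μ u)) (mker β β' μ κ u) := by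
  rw [mker_of_mem_APos hu]
  exact hβ.stochLE_fst (quad μ κ u) (h.quad_mem_quadruples hu)

lemma mker_stochLE (hu : u ∈ ANeg μ κ) : StochLE (mker β β' μ κ u) (κ (quantile μ u)) := by
  have hst : StochLE (β' (quad μ κ (phi μ κ u))) (κ (quantile μ (phi μ κ (phi μ κ u)))) :=
    hβ.stochLE_snd (quad μ κ (phi μ κ u)) (h.quad_mem_quadruples (phi_mem_APos hu))
  rwa [mker_of_mem_ANeg hu, ← congrArg (fun v => κ (quantile μ v)) hu.2.2.1]

lemma ae_W1_mker : ∀ᵐ u ∂lam,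
    W1 (κ (quantile μ u)) (mker β β' μ κ u) = ENNReal.ofReal |G μ κ u - quantile μ u| := by
  filter_upwards [h.ae_G_eq_quantile, h.ae_integrable_quantile,
    h.ae_integrable_mker_and_mean_eq hβ] with u hG hint hmart
  have := h.isProbabilityMeasure_mker hβ u
  by_cases hpos : u ∈ APos μ κ
  · rw [W1_eq_of_stochLE hint hmart.1 (h.stochLE_mker hβ hpos), hmart.2, G]
  by_cases hneg : u ∈ ANeg μ κ
  · rw [W1_comm, W1_eq_of_stochLE hmart.1 hint (h.mker_stochLE hβ hneg), hmart.2, abs_sub_comm, G]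
  · rw [mker_of_notMem hpos hneg, W1_self, hG hpos hneg, sub_self, abs_zero, ENNReal.ofReal_zero]

lemma mker_add_mker_phi (hu : u ∈ APos μ κ) (S : Set ℝ) :
    mker β β' μ κ u S + ENNReal.ofReal (1 - pw μ κ u) / ENNReal.ofReal (pw μ κ u) *
        mker β β' μ κ (phi μ κ u) S =
      κ (quantile μ u) S + ENNReal.ofReal (1 - pw μ κ u) / ENNReal.ofReal (pw μ κ u) *
        κ (quantile μ (phi μ κ u)) S := by
  have hpw : ENNReal.ofReal (pw μ κ u) ≠ 0 := (ENNReal.ofReal_pos.2 (pw_mem_Ioo hu).1).ne'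
  have hcancel (x : ENNReal) : ENNReal.ofReal (pw μ κ u) *
      (ENNReal.ofReal (1 - pw μ κ u) / ENNReal.ofReal (pw μ κ u) * x) =
        ENNReal.ofReal (1 - pw μ κ u) * x := by
    rw [← mul_assoc, ENNReal.mul_div_cancel hpw ENNReal.ofReal_ne_top]
  rw [mker_of_mem_APos hu, mker_of_mem_ANeg (phi_mem_ANeg hu), hu.2.2.1,
    ← ENNReal.mul_right_inj hpw ENNReal.ofReal_ne_top, mul_add, mul_add, hcancel, hcancel]
  exact congrArg (fun ρ : Measure ℝ => ρ S) (hβ.mixture _ (h.quad_mem_quadruples hu))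

lemma lintegral_mker {S : Set ℝ} (hS : MeasurableSet S) :
    ∫⁻ u, mker β β' μ κ u S ∂lam = ∫⁻ u, κ (quantile μ u) S ∂lam := by
  have hmker : Measurable fun u => mker β β' μ κ u S :=
    (Measure.measurable_coe hS).comp (h.measurable_mker hβ)
  have hκ : Measurable fun u => κ (quantile μ u) S :=
    (κ.measurable_coe hS).comp (measurable_quantile μ)
  have hunion := h.measurableSet_APos.union h.measurableSet_ANeg
  have hsplit {f : ℝ → ENNReal} (hf : Measurable f) : ∫⁻ u, f u ∂lam =
      ∫⁻ u in APos μ κ, (f u +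
        ENNReal.ofReal (1 - pw μ κ u) / ENNReal.ofReal (pw μ κ u) * f (phi μ κ u)) ∂lam +
      ∫⁻ u in (APos μ κ ∪ ANeg μ κ)ᶜ, f u ∂lam := by
    rw [lintegral_add_left hf, ← h.setLIntegral_ANeg hf, ← lintegral_union h.measurableSet_ANeg
      (disjoint_left.2 fun u hpos hneg => notMem_APos_of_mem_ANeg hneg hpos),
      lintegral_add_compl _ hunion]
  rw [hsplit hmker, hsplit hκ]
  congr 1
  · exact setLIntegral_congr_fun h.measurableSet_APos fun u hu => h.mker_add_mker_phi hβ hu S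
  · refine setLIntegral_congr_fun hunion.compl fun u hu => ?_
    exact congrArg (fun ρ : Measure ℝ => ρ S)
      (mker_of_notMem (fun hpos => hu (.inl hpos)) fun hneg => hu (.inr hneg))

/-- The family `mker` as a kernel. -/
noncomputable def mkernel : Kernel ℝ ℝ := ⟨mker β β' μ κ, h.measurable_mker hβ⟩

instance : IsMarkovKernel (h.mkernel hβ) := ⟨h.isProbabilityMeasure_mker hβ⟩

lemma bind_mkernel : lam.bind (h.mkernel hβ) = μ.bind κ := by
  ext S hS
  rw [← bind_quantileKernel μ, Measure.bind_apply hS (Kernel.aemeasurable _),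
    Measure.bind_apply hS (Kernel.aemeasurable _)]
  exact h.lintegral_mker hβ hS

lemma isLiftedMartingaleCoupling_Mhat (hπ : IsCoupling μ ν (μ ⊗ₘ κ)) :
    IsLiftedMartingaleCoupling μ ν (Mhat β β' μ κ) := by
  have hbind : lam.bind (h.mkernel hβ) = ν :=
    (h.bind_mkernel hβ).trans ((Measure.snd_compProd μ κ).symm.trans hπ.2)
  exact ⟨⟨_, hbind ▸ isCoupling_map_snd_lift, ⟨h.mkernel hβ, inferInstance, rfl⟩, rfl⟩,
    h.mkernel hβ, inferInstance, rfl, h.ae_integrable_mker_and_mean_eq hβ⟩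

lemma isLiftedMartingaleRearrangement_Mhat (hπ : IsCoupling μ ν (μ ⊗ₘ κ)) :
    IsLiftedMartingaleRearrangement μ ν (iota μ κ) (Mhat β β' μ κ) :=
  isLiftedMartingaleRearrangement_of_W1_eq (p := quantileKernel μ κ) (p' := h.mkernel hβ)
    h.ae_integrable_quantile (h.isLiftedMartingaleCoupling_Mhat hβ hπ) (h.ae_W1_mker hβ)

lemma liftedAW1_iota_Mhat (hπ : IsCoupling μ ν (μ ⊗ₘ κ)) :
    liftedAW1 (iota μ κ) (Mhat β β' μ κ) =
      ∫⁻ u, W1 (κ (quantile μ u)) (mker β β' μ κ u) ∂lam :=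
  liftedAW1_eq_lintegral_of_W1_eq (p := quantileKernel μ κ) (p' := h.mkernel hβ)
    h.ae_integrable_quantile (h.isLiftedMartingaleCoupling_Mhat hβ hπ) (h.ae_W1_mker hβ)

lemma lintegral_W1_mker : ∫⁻ u, W1 (κ (quantile μ u)) (mker β β' μ κ u) ∂lam =
    ENNReal.ofReal (∫ u, |G μ κ u - quantile μ u| ∂lam) := by
  rw [lintegral_congr_ae (h.ae_W1_mker hβ), ofReal_integral_eq_lintegral_ofReal
    h.integrable_abs_G_sub_quantile (.of_forall fun _ => abs_nonneg _)]

end IsDispersed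

lemma mean_eq_of_convexOrder (hμ : IsP1 μ) (hν : IsP1 ν) (hcx : ConvexOrder μ ν) :
    ∫ x, x ∂μ = ∫ y, y ∂ν := by
  refine (hcx _ (convexOn_id convex_univ) hμ.2 hν.2).antisymm ?_
  have hneg := hcx (fun x => -x) (concaveOn_id convex_univ).neg hμ.2.neg hν.2.neg
  rwa [integral_neg, integral_neg, neg_le_neg_iff] at hneg

lemma isDispersed_of_mean_eq (hμ : IsP1 μ) (hν : IsP1 ν) (hmean : ∫ x, x ∂μ = ∫ y, y ∂ν)
    (hπ : IsCoupling μ ν (μ ⊗ₘ κ)) (hbd : BarycentreDispersion μ κ) : IsDispersed μ κ where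
  integrable_fst := hμ.2
  integrable_snd := hπ.integrable_snd hν.2
  mean_eq := hmean.trans (hπ.integral_snd hν.2.aestronglyMeasurable).symm
  dispersion := hbd

end Mker

end MartRearr

theorem mainTheorem2 (μ ν : Measure ℝ) (hμ : IsP1 μ) (hν : IsP1 ν) (hcx : ConvexOrder μ ν)
    (hne : μ ≠ ν) (π : Measure (ℝ × ℝ)) (hπ : IsCoupling μ ν π)
    (κ : Kernel ℝ ℝ) [IsMarkovKernel κ] (hκ : π = μ ⊗ₘ κ) (hbd : BarycentreDispersion μ κ) :
    IsExchange exchangeFst exchangeSnd ∧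
    ∀ β β' : ℝ × ℝ × Measure ℝ × Measure ℝ → Measure ℝ, IsExchange β β' →
      Measurable (mker β β' μ κ) ∧
      (∀ u, IsProbabilityMeasure (mker β β' μ κ u)) ∧
      IsLiftOf μ π (iota μ κ) ∧
      IsLiftedMartingaleRearrangement μ ν (iota μ κ) (Mhat β β' μ κ) ∧
      infLiftedAW1 μ ν (iota μ κ) = liftedAW1 (iota μ κ) (Mhat β β' μ κ) ∧
      liftedAW1 (iota μ κ) (Mhat β β' μ κ) =
        ∫⁻ u in Ioo (0 : ℝ) 1, W1 (κ (quantile μ u)) (mker β β' μ κ u) ∧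
      IntegrableOn (fun u => |G μ κ u - quantile μ u|) (Ioo (0 : ℝ) 1) ∧
      ∫⁻ u in Ioo (0 : ℝ) 1, W1 (κ (quantile μ u)) (mker β β' μ κ u) =
        ENNReal.ofReal (∫ u in Ioo (0 : ℝ) 1, |G μ κ u - quantile μ u|) := by
  refine ⟨isExchange_exchangeFst_exchangeSnd, fun β β' hβ => ?_⟩
  subst hκ
  have := hμ.1
  have h : IsDispersed μ κ :=
    isDispersed_of_mean_eq hμ hν (mean_eq_of_convexOrder hμ hν hcx) hπ hbd
  have hM := h.isLiftedMartingaleRearrangement_Mhat hβ hπ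
  exact ⟨h.measurable_mker hβ, h.isProbabilityMeasure_mker hβ, isLiftOf_iota μ κ, hM, hM.2.symm,
    h.liftedAW1_iota_Mhat hβ hπ, h.integrable_abs_G_sub_quantile, h.lintegral_W1_mker hβ⟩
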